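/- Throughout, manifolds are smooth, Hausdorff and second countable, and all tensors, sections and connections are smooth. For $\epsilon=\pm1$ and a field $J$ of endomorphisms of $TM$ with $J^2=\epsilon\,\mathrm{Id}$, put $N_J(X,Y)=\epsilon[X,Y]+[JX,JY]-J([JX,Y]+[X,JY])$. A complex structure on $M$ is a $J$ with $J^2=-\mathrm{Id}$ and $N_J=0$; a para-complex structure is a $J$ with $J^2=\mathrm{Id}$, $\operatorname{rank}\ker(J-\mathrm{Id})=\operatorname{rank}\ker(J+\mathrm{Id})$ and $N_J=0$. (Without the condition $N_J=0$ one speaks of almost (para-)complex structures.) An almost para-quaternionic structure on a manifold $M$ of dimension $4m\ge 8$ is a rank three sub-bundle $\mathcal P\subset\mathrm{End}(TM)$ which is locally spanned by triples $\{J_1,J_2,J_3\}$ (admissible bases), where $J_1$ is an almost complex structure, $J_2,J_3$ are anti-commuting almost para-complex structures and $J_3=J_1J_2$. Its standard Lorentzian metric is given, in any admissible basis, by $\langle\sum_i a_iJ_i,\sum_j b_jJ_j\rangle=-a_1b_1+a_2b_2+a_3b_3$. The pair $(M,\mathcal P)$ is para-quaternionic if $M$ has a torsion-free linear connection which preserves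 the bundle $\mathcal P$. A (para-)complex structure is compatible if it is a section of $\mathcal P$, and a system of such structures is independent if it is linearly independent at every point of $M$. **Theorem 4.1.** Let $(M,\mathcal P)$ be an almost para-quaternionic manifold of dimension $4m\ge 8$. Suppose that one of the following holds: 1. there are two globally defined, independent, compatible structures $I_1$ and $I_2$, each of them complex or para-complex, such that $I_1$ or $I_2$ is a complex structure; 2. there are two globally defined, independent, compatible para-complex structures $I_1$ and $I_2$ such that at every $p\in M$ the $2$-plane $\mathrm{Span}\{I_1(p),I_2(p)\}$ is non-degenerate with respect to $\langle\cdot,\cdot\rangle$; 3. there are three globally defined, pairwise independent, compatible para-complex structures $I_1,I_2,I_3$ such that at every $p\in M$ the endomorphisms $I_1(p),I_2(p),I_3(p)$ are linearly dependent and, for all $i\ne j$, the $2$-plane $\mathrm{Span}\{I_i(p),I_j(p)\}$ is degenerate. Then $(M,\mathcal P)$ is para-quaternionic. -/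

import Mathlib

open scoped Manifold ContDiff Bundle

noncomputable section

namespace ParaQuat

section LinearAlgebra

variable {V : Type*} [AddCommGroup V] [Module ℝ V] [TopologicalSpace V]
  [IsTopologicalAddGroup V] [ContinuousConstSMul ℝ V]

/-- A linear complex structure: `A² = -Id`. -/
def IsComplexEnd (A : V →L[ℝ] V) : Prop :=
  A * A = -1

/-- A linear para-complex structure: `A² = Id`, and the eigenspaces `Ker (A - Id)` and
`Ker (A + Id)` have the same dimension. -/
def IsParaComplexEnd (A : V →L[ℝ] V) : Prop :=
  A * A = 1 ∧
    Module.finrank ℝ (LinearMap.ker ((A - 1 : V →L[ℝ] V) : V →ₗ[ℝ] V)) =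
      Module.finrank ℝ (LinearMap.ker ((A + 1 : V →L[ℝ] V) : V →ₗ[ℝ] V))

/-- A linear para-hypercomplex structure: `J₁` is complex, `J₂` and `J₃` are anti-commuting
para-complex structures, and `J₃ = J₁ J₂`. -/
structure IsAdmissibleTriple (J₁ J₂ J₃ : V →L[ℝ] V) : Prop where
  isComplex : IsComplexEnd J₁
  isParaComplex₂ : IsParaComplexEnd J₂
  isParaComplex₃ : IsParaComplexEnd J₃
  anticomm : J₂ * J₃ = -(J₃ * J₂)
  eq_mul : J₃ = J₁ * J₂

/-- The bilinear form `⟨A, B⟩ = tr (A B) / dim V` on endomorphisms of `V`. On the span of an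
admissible triple it is the standard Lorentzian metric, for which the triple is orthogonal with
squares `-1, 1, 1`: see `stdMetric_sum`. -/
def stdMetric : LinearMap.BilinForm ℝ (V →L[ℝ] V) :=
  LinearMap.mk₂ ℝ
    (fun A B => (Module.finrank ℝ V : ℝ)⁻¹ *
      LinearMap.trace ℝ V ((A : V →ₗ[ℝ] V) * (B : V →ₗ[ℝ] V)))
    (fun A A' B => by
      simp only [ContinuousLinearMap.toLinearMap_add, add_mul, map_add, mul_add])
    (fun c A B => by
      simp only [ContinuousLinearMap.toLinearMap_smul, smul_mul_assoc, map_smul, smul_eq_mul]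
      ring)
    (fun A B B' => by
      simp only [ContinuousLinearMap.toLinearMap_add, map_add, mul_add])
    (fun c A B => by
      simp only [ContinuousLinearMap.toLinearMap_smul, mul_smul_comm, map_smul, smul_eq_mul]
      ring)

theorem stdMetric_apply (A B : V →L[ℝ] V) :
    stdMetric A B = (Module.finrank ℝ V : ℝ)⁻¹ *
      LinearMap.trace ℝ V ((A * B : V →L[ℝ] V) : V →ₗ[ℝ] V) := rfl

theorem stdMetric_comm (A B : V →L[ℝ] V) : stdMetric A B = stdMetric B A := by
  change _ * LinearMap.trace ℝ V ((A : V →ₗ[ℝ] V) * (B : V →ₗ[ℝ] V)) =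
    _ * LinearMap.trace ℝ V ((B : V →ₗ[ℝ] V) * (A : V →ₗ[ℝ] V))
  rw [LinearMap.trace_mul_comm]

theorem stdMetric_eq_zero {A B : V →L[ℝ] V} (h : A * B = -(B * A)) : stdMetric A B = 0 := by
  have h1 : stdMetric A B = - stdMetric B A := by
    rw [stdMetric_apply, stdMetric_apply, h, ContinuousLinearMap.toLinearMap_neg, map_neg,
      mul_neg]
  have h2 := stdMetric_comm A B
  linarith

theorem stdMetric_self (hV : Module.finrank ℝ V ≠ 0) {A : V →L[ℝ] V} {c : ℝ}
    (h : A * A = c • (1 : V →L[ℝ] V)) : stdMetric A A = c := by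
  have h1 : ((1 : V →L[ℝ] V) : V →ₗ[ℝ] V) = 1 := rfl
  have hV' : (Module.finrank ℝ V : ℝ) ≠ 0 := by exact_mod_cast hV
  have : FiniteDimensional ℝ V := Module.finite_of_finrank_pos (Nat.pos_of_ne_zero hV)
  rw [stdMetric_apply, h, ContinuousLinearMap.toLinearMap_smul, map_smul, h1, LinearMap.trace_one,
    smul_eq_mul]
  field_simp

/-- The formula that defines the standard metric, in an arbitrary admissible basis. -/
theorem stdMetric_sum (hV : Module.finrank ℝ V ≠ 0) {J₁ J₂ J₃ : V →L[ℝ] V}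
    (h : IsAdmissibleTriple J₁ J₂ J₃) (a₁ a₂ a₃ b₁ b₂ b₃ : ℝ) :
    stdMetric (a₁ • J₁ + a₂ • J₂ + a₃ • J₃) (b₁ • J₁ + b₂ • J₂ + b₃ • J₃) =
      -(a₁ * b₁) + a₂ * b₂ + a₃ * b₃ := by
  have s1 : J₁ * J₁ = -1 := h.isComplex
  have s2 : J₂ * J₂ = 1 := h.isParaComplex₂.1
  have s3 : J₃ * J₃ = 1 := h.isParaComplex₃.1
  have h32 : J₃ * J₂ = J₁ := by rw [h.eq_mul, mul_assoc, s2, mul_one]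
  have h23 : J₂ * J₃ = -J₁ := by rw [h.anticomm, h32]
  have h13 : J₁ * J₃ = -J₂ := by rw [h.eq_mul, ← mul_assoc, s1, neg_one_mul]
  have h21 : J₂ * J₁ = -J₃ := by rw [← h32, ← mul_assoc, h23, neg_mul, ← h.eq_mul]
  have h31 : J₃ * J₁ = J₂ := by rw [← h32, ← mul_assoc, s3, one_mul]
  have e12 : stdMetric J₁ J₂ = 0 := stdMetric_eq_zero (by rw [h21, neg_neg, ← h.eq_mul])
  have e13 : stdMetric J₁ J₃ = 0 := stdMetric_eq_zero (by rw [h31, h13])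
  have e23 : stdMetric J₂ J₃ = 0 := stdMetric_eq_zero h.anticomm
  have e11 : stdMetric J₁ J₁ = -1 := stdMetric_self hV (by rw [s1]; simp)
  have e22 : stdMetric J₂ J₂ = 1 := stdMetric_self hV (by rw [s2]; simp)
  have e33 : stdMetric J₃ J₃ = 1 := stdMetric_self hV (by rw [s3]; simp)
  simp only [map_add, map_smul, LinearMap.add_apply, LinearMap.smul_apply, smul_eq_mul,
    e12, e13, e23, e11, e22, e33, stdMetric_comm J₂ J₁, stdMetric_comm J₃ J₁,
    stdMetric_comm J₃ J₂]
  ring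

/-- The span of `A` and `B` is a non-degenerate subspace for the standard metric. -/
def IsNondegenerateSpan (A B : V →L[ℝ] V) : Prop :=
  ((stdMetric (V := V)).restrict (Submodule.span ℝ {A, B})).Nondegenerate

end LinearAlgebra

section Manifold

variable {n : ℕ} {M : Type*} [TopologicalSpace M] [ChartedSpace (EuclideanSpace ℝ (Fin n)) M]

/-- Vector fields on `M`, without regularity. -/
abbrev VField (n : ℕ) (M : Type*) [TopologicalSpace M]
    [ChartedSpace (EuclideanSpace ℝ (Fin n)) M] : Type _ :=
  ∀ x : M, TangentSpace (𝓡 n) x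

/-- Fields of endomorphisms of `TM`, without regularity. -/
abbrev EndField (n : ℕ) (M : Type*) [TopologicalSpace M]
    [ChartedSpace (EuclideanSpace ℝ (Fin n)) M] : Type _ :=
  ∀ x : M, TangentSpace (𝓡 n) x →L[ℝ] TangentSpace (𝓡 n) x

variable [IsManifold (𝓡 n) ∞ M]

/-- `X` is a smooth vector field. -/
def SmoothVField (X : VField n M) : Prop :=
  ContMDiff (𝓡 n) (𝓡 n).tangent ∞
    (fun x => (⟨x, X x⟩ : TangentBundle (𝓡 n) M))

/-- `A` is a smooth section of `End(TM)` over `U`. -/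
def SmoothEndOn (A : EndField n M) (U : Set M) : Prop :=
  ContMDiffOn (𝓡 n)
    ((𝓡 n).prod 𝓘(ℝ, EuclideanSpace ℝ (Fin n) →L[ℝ] EuclideanSpace ℝ (Fin n))) ∞
    (fun x => (⟨x, A x⟩ :
      Bundle.TotalSpace (EuclideanSpace ℝ (Fin n) →L[ℝ] EuclideanSpace ℝ (Fin n))
        (fun x : M => TangentSpace (𝓡 n) x →L[ℝ] TangentSpace (𝓡 n) x))) U

/-- The expression `ε [X, Y] + [JX, JY] - J ([JX, Y] + [X, JY])`, which is the Nijenhuis tensor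
of `J` when `J² = ε Id`. -/
def nijenhuis (ε : ℝ) (J : EndField n M) (X Y : VField n M) : VField n M := fun x =>
  ε • VectorField.mlieBracket (𝓡 n) X Y x
    + VectorField.mlieBracket (𝓡 n) (fun y => J y (X y)) (fun y => J y (Y y)) x
    - J x (VectorField.mlieBracket (𝓡 n) (fun y => J y (X y)) Y x
      + VectorField.mlieBracket (𝓡 n) X (fun y => J y (Y y)) x)

/-- `J` is an (integrable) complex structure. -/
structure IsComplexStructure (J : EndField n M) : Prop where
  smooth : SmoothEndOn J Set.univ
  isComplex : ∀ x, IsComplexEnd (J x)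
  integrable : ∀ X Y : VField n M, SmoothVField X → SmoothVField Y →
    ∀ x, nijenhuis (-1) J X Y x = 0

/-- `J` is an (integrable) para-complex structure. -/
structure IsParaComplexStructure (J : EndField n M) : Prop where
  smooth : SmoothEndOn J Set.univ
  isParaComplex : ∀ x, IsParaComplexEnd (J x)
  integrable : ∀ X Y : VField n M, SmoothVField X → SmoothVField Y →
    ∀ x, nijenhuis 1 J X Y x = 0

variable (n M) in
/-- An almost para-quaternionic structure: a sub-bundle of `End(TM)` locally spanned by smooth
almost para-hypercomplex structures. -/
structure AlmostParaQuaternionic where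
  fiber : ∀ x : M, Submodule ℝ (TangentSpace (𝓡 n) x →L[ℝ] TangentSpace (𝓡 n) x)
  exists_frame : ∀ p : M, ∃ U : Set M, IsOpen U ∧ p ∈ U ∧ ∃ J₁ J₂ J₃ : EndField n M,
    SmoothEndOn J₁ U ∧ SmoothEndOn J₂ U ∧ SmoothEndOn J₃ U ∧
      ∀ x ∈ U, IsAdmissibleTriple (J₁ x) (J₂ x) (J₃ x) ∧
        fiber x = Submodule.span ℝ {J₁ x, J₂ x, J₃ x}

namespace AlmostParaQuaternionic

/-- `A` is a section of the bundle `P`. -/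
def Compatible (P : AlmostParaQuaternionic n M) (A : EndField n M) : Prop :=
  ∀ x, A x ∈ P.fiber x

/-- The connection `∇` on `TM` preserves `P`: for every smooth section `A` of `P` and every tangent
vector `v` at `p`, the endomorphism `∇_v A` of `T_pM`, given by
`(∇_v A) (Y_p) = ∇_v (A Y) - A (∇_v Y)`, belongs to the fibre of `P` at `p`. -/
def Preserves (P : AlmostParaQuaternionic n M)
    (nabla : CovariantDerivative (𝓡 n) (EuclideanSpace ℝ (Fin n))
      (TangentSpace (𝓡 n) : M → Type _)) : Prop :=
  ∀ A : EndField n M, SmoothEndOn A Set.univ → P.Compatible A →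
    ∀ (p : M) (v : TangentSpace (𝓡 n) p), ∃ B ∈ P.fiber p,
      ∀ Y : VField n M, SmoothVField Y →
        B (Y p) = nabla (fun x => A x (Y x)) p v - A p (nabla Y p v)

/-- `P` is para-quaternionic (integrable): there is a smooth torsion-free linear connection which
preserves `P`. -/
def IsParaQuaternionic (P : AlmostParaQuaternionic n M) : Prop :=
  ∃ nabla : CovariantDerivative (𝓡 n) (EuclideanSpace ℝ (Fin n))
      (TangentSpace (𝓡 n) : M → Type _),
    CovariantDerivative.ContMDiffCovariantDerivative nabla ∞ ∧ P.Preserves nabla ∧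
      CovariantDerivative.torsion nabla = 0

end AlmostParaQuaternionic

end Manifold

end ParaQuat

end

/-! Near a point, an adapted frame identifies `TM` with `E ⊗ ℝ²` so that `P` becomes `Id ⊗ sl(2,
ℝ)`; with coefficient triples for matrices, the standard metric is minus the determinant. Let `T` be
the torsion of the connection for which the frame is parallel. Subtracting from this connection a
bilinear field `Γ` with values in the normalizer of `sl(2)` gives a connection that still preserves
`P`, and the result is torsion-free as soon as the skew-symmetrization of `Γ` is `T`. The problem is
therefore pointwise and linear: is `T` the skew-symmetrization of a normalizer-valued bilinear map?

The obstruction is the cubic `h ↦ ω(h, T(e ⊗ h, f ⊗ h))` on `ℝ²`, with `ω` the area form, whose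
coefficients are taken modulo the maps `α ∧ Id`. If its four coefficients vanish in this quotient,
`exists_normalizerForm` writes down a solution. An integrable structure with matrix `A` forces `3
c(Ah, Ah, h) + ⟨A, A⟩ c(h, h, h) = 0` for this cubic `c` (`NijenhuisCondition.cubicDefect_mem`), and
this makes `c` divisible by the quadratic form `q_A(h) = ω(h, Ah)` (`exists_factor_of_cubicDefect`).

It remains to see that the given structures leave only `c = 0`. The resultant of `q_A` and `q_B` is,
up to a constant, the Gram determinant of `A` and `B`. If the plane they span is non-degenerate, the
two forms are coprime, and a cubic divisible by both is zero. This covers the first two cases,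
because a plane containing a timelike vector is never degenerate. In a degenerate plane all the
forms share one linear factor, so two of them allow a nonzero cubic, but three pairwise independent
ones have a least common multiple of degree four.

A linear choice of `Γ` in terms of `T` makes it smooth, and a partition of unity glues the local
connections. -/

open scoped Manifold ContDiff Bundle

noncomputable section

namespace ParaQuat

/-! ### Binary cubics annihilated by the integrability conditions. -/

section Cubic

/-- The Lorentzian form on coefficient triples with respect to an admissible basis. -/
def lorentz (v w : Fin 3 → ℝ) : ℝ := -(v 0 * w 0) + v 1 * w 1 + v 2 * w 2

/-- For the traceless matrix `A` with coefficient triple `v` and `h = (s, t)`, the value at `h` of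
`3 c(A h, A h, h) + ⟨v, v⟩ c(h, h, h)`, where `c` is the symmetric trilinear form with
`c(h, h, h) = c₀ s³ + c₁ s² t + c₂ s t² + c₃ t³`. -/
def cubicDefect {W : Type*} [AddCommGroup W] [Module ℝ W] (v : Fin 3 → ℝ) (c₀ c₁ c₂ c₃ : W)
    (s t : ℝ) : W :=
  let k := v 1 * s + (v 2 - v 0) * t
  let l := (v 0 + v 2) * s - v 1 * t
  (3 * k ^ 2 * s + lorentz v v * s ^ 3) • c₀
    + (k ^ 2 * t + 2 * k * l * s + lorentz v v * (s ^ 2 * t)) • c₁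
    + (l ^ 2 * s + 2 * k * l * t + lorentz v v * (s * t ^ 2)) • c₂
    + (3 * l ^ 2 * t + lorentz v v * t ^ 3) • c₃

/-- A set of coefficient triples such that only the zero cubic has vanishing defect with respect to
all of its elements. -/
def DeterminesCubics (S : Set (Fin 3 → ℝ)) : Prop :=
  ∀ c₀ c₁ c₂ c₃ : ℝ, (∀ v ∈ S, ∀ s t, cubicDefect v c₀ c₁ c₂ c₃ s t = 0) →
    c₀ = 0 ∧ c₁ = 0 ∧ c₂ = 0 ∧ c₃ = 0

/-- A cubic with vanishing defect is divisible by the quadratic form of the matrix. -/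
theorem exists_factor_of_cubicDefect {v : Fin 3 → ℝ} (hv : lorentz v v ^ 2 = 1)
    {c₀ c₁ c₂ c₃ : ℝ} (h : ∀ s t, cubicDefect v c₀ c₁ c₂ c₃ s t = 0) :
    ∃ m n : ℝ, c₀ = (v 0 + v 2) * m ∧ c₁ = (v 0 + v 2) * n - 2 * v 1 * m ∧
      c₂ = -2 * v 1 * n - (v 2 - v 0) * m ∧ c₃ = -(v 2 - v 0) * n := by
  have h10 := h 1 0
  have h01 := h 0 1
  have h11 := h 1 1
  have h12 := h 1 (-1)
  obtain ⟨e, he⟩ : ∃ e, e = lorentz v v := ⟨_, rfl⟩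
  have hd := he
  simp only [cubicDefect, smul_eq_mul, ← he] at h10 h01 h11 h12
  rw [← he] at hv
  simp only [lorentz] at hd
  obtain ⟨x, hx⟩ : ∃ x, x = v 0 := ⟨_, rfl⟩
  obtain ⟨a, ha⟩ : ∃ a, a = v 1 := ⟨_, rfl⟩
  obtain ⟨z, hz⟩ : ∃ z, z = v 2 := ⟨_, rfl⟩
  simp only [← hx, ← ha, ← hz] at h10 h01 h11 h12 hd ⊢
  obtain ⟨b, hb⟩ : ∃ b, b = z - x := ⟨_, rfl⟩
  obtain ⟨c, hc⟩ : ∃ c, c = x + z := ⟨_, rfl⟩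
  simp only [← hb, ← hc] at h10 h01 h11 h12 ⊢
  have hd' : e = a ^ 2 + b * c := by rw [hd, hb, hc]; ring
  -- For every cubic, `3 (c(Ah, Ah, h) - e c(h, h, h))` equals `q_A(h)` times a linear form `L`, a
  -- contraction of `c` with `A`. Vanishing defect turns the left side into `-4 e c(h, h, h)`, and
  -- `e² = 1` gives `c = -(e / 4) q_A L`; the witnesses are the coefficients of `-(e / 4) L`. The
  -- values at `(1, 0)`, `(0, 1)`, `(1, ±1)` recover the four coefficients of the defect.
  refine ⟨-(3 / 4) * e * (c * c₂ / 3 + 2 * a * c₁ / 3 - b * c₀),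
    -(3 / 4) * e * (c * c₃ + 2 * a * c₂ / 3 - b * c₁ / 3), ?_, ?_, ?_, ?_⟩
  · linear_combination (-c₀) * hv + e / 4 * h10 + (3 / 4) * e * c₀ * hd'
  · linear_combination (-c₁) * hv + e / 4 * ((h11 - h12) / 2 - h01) + (3 / 4) * e * c₁ * hd'
  · linear_combination (-c₂) * hv + e / 4 * ((h11 + h12) / 2 - h10) + (3 / 4) * e * c₂ * hd'
  · linear_combination (-c₃) * hv + e / 4 * h01 + (3 / 4) * e * c₃ * hd'

/-- The cubic is both `q_v (m s + n t)` and `q_w (m' s + n' t)`. Comparing coefficients gives a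
linear system whose matrix is, up to signs of columns, the Sylvester matrix of `q_v` and `q_w`; its
determinant is a multiple of the Gram determinant, so both linear factors vanish. -/
theorem determinesCubics_of_gram_ne_zero {S : Set (Fin 3 → ℝ)} {v w : Fin 3 → ℝ} (hv : v ∈ S)
    (hw : w ∈ S) (hv1 : lorentz v v ^ 2 = 1) (hw1 : lorentz w w ^ 2 = 1)
    (hg : lorentz v v * lorentz w w - lorentz v w ^ 2 ≠ 0) : DeterminesCubics S := by
  intro c₀ c₁ c₂ c₃ h
  obtain ⟨m, n, e0, e1, e2, e3⟩ := exists_factor_of_cubicDefect hv1 (h v hv)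
  obtain ⟨m', n', f0, f1, f2, f3⟩ := exists_factor_of_cubicDefect hw1 (h w hw)
  let A : Matrix (Fin 4) (Fin 4) ℝ := !![v 0 + v 2, 0, -(w 0 + w 2), 0;
    -2 * v 1, v 0 + v 2, 2 * w 1, -(w 0 + w 2);
    -(v 2 - v 0), -2 * v 1, w 2 - w 0, 2 * w 1;
    0, -(v 2 - v 0), 0, w 2 - w 0]
  have hdet : A.det = -4 * (lorentz v v * lorentz w w - lorentz v w ^ 2) := by
    simp [A, Matrix.det_succ_row_zero, Fin.sum_univ_succ, Fin.succAbove, lorentz]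
    ring
  have hz := Matrix.eq_zero_of_mulVec_eq_zero (M := A) (v := ![m, n, m', n'])
    (by rw [hdet]; simpa using hg) (by
      ext i
      fin_cases i <;> simp [A, Matrix.mulVec, dotProduct, Fin.sum_univ_succ] <;> linarith)
  have hm : m = 0 := congrFun hz 0
  have hn : n = 0 := congrFun hz 1
  simp only [hm, hn, mul_zero, sub_zero] at e0 e1 e2 e3
  exact ⟨e0, e1, e2, e3⟩

/-- The plane spanned by a timelike unit vector and an independent vector is non-degenerate. -/
theorem gram_ne_zero_of_timelike {v w : Fin 3 → ℝ} (hv : lorentz v v = -1)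
    (hw : lorentz w w = 1 ∨ lorentz w w = -1) (hvw : LinearIndependent ℝ ![v, w]) :
    lorentz v v * lorentz w w - lorentz v w ^ 2 ≠ 0 := by
  intro hg
  rw [hv] at hg
  rw [LinearIndependent.pair_iff] at hvw
  rcases hw with hw | hw
  -- For spacelike `w` the Gram determinant is `-1 - ⟨v, w⟩²`, which is negative.
  · rw [hw] at hg; nlinarith [sq_nonneg (lorentz v w)]
  · rw [hw] at hg
    obtain ⟨g, hgd⟩ : ∃ g, g = lorentz v w := ⟨_, rfl⟩
    have hg2 : g ^ 2 = 1 := by rw [hgd]; linarith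
    -- the vector `w + g v` is null and orthogonal to `v`
    have key : ∀ u : Fin 3 → ℝ, lorentz u u = 0 → lorentz v u = 0 → u = 0 := by
      intro u h1 h2
      simp only [lorentz] at hv h1 h2
      -- An explicit sum of squares expressing that the orthogonal complement of a timelike vector
      -- is positive definite.
      have h3 : (v 1 * u 0 - v 0 * u 1) ^ 2 + (v 2 * u 0 - v 0 * u 2) ^ 2 + u 0 ^ 2 = 0 := by
        linear_combination (v 0) ^ 2 * h1 + u 0 ^ 2 * hv - 2 * u 0 * v 0 * h2
      have h0 : u 0 = 0 := by
        nlinarith [sq_nonneg (v 1 * u 0 - v 0 * u 1),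
        sq_nonneg (v 2 * u 0 - v 0 * u 2), sq_nonneg (u 0)]
      rw [h0] at h1
      have h11 : u 1 = 0 := by nlinarith [sq_nonneg (u 1), sq_nonneg (u 2)]
      have h12 : u 2 = 0 := by nlinarith [sq_nonneg (u 1), sq_nonneg (u 2)]
      ext i; fin_cases i <;> assumption
    have := key (g • v + (1 : ℝ) • w) (by
      simp only [lorentz, Pi.add_apply, Pi.smul_apply, smul_eq_mul] at *
      linear_combination g ^ 2 * hv + hw - 2 * g * hgd + hg2 ) (by
      simp only [lorentz, Pi.add_apply, Pi.smul_apply, smul_eq_mul] at *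
      linear_combination g * hv - hgd)
    exact one_ne_zero (hvw _ _ this).2

/-- A cubic whose defect vanishes at three members of a null pencil of matrices is zero. -/
theorem eq_zero_of_cubicDefect_pencil {v n : Fin 3 → ℝ} (hv : lorentz v v = 1)
    (hn : lorentz n n = 0) (hvn : lorentz v n = 0) (hn0 : n ≠ 0) {μ : ℝ} (hμ0 : μ ≠ 0)
    (hμ1 : μ ≠ 1) {c₀ c₁ c₂ c₃ : ℝ} (h0 : ∀ s t, cubicDefect v c₀ c₁ c₂ c₃ s t = 0)
    (h1 : ∀ s t, cubicDefect (v + n) c₀ c₁ c₂ c₃ s t = 0)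
    (h2 : ∀ s t, cubicDefect (v + μ • n) c₀ c₁ c₂ c₃ s t = 0) :
    c₀ = 0 ∧ c₁ = 0 ∧ c₂ = 0 ∧ c₃ = 0 := by
  have e1 : lorentz (v + n) (v + n) = 1 := by
    simp only [lorentz, Pi.add_apply] at *
    linear_combination hv + hn + 2 * hvn
  have e2 : lorentz (v + μ • n) (v + μ • n) = 1 := by
    simp only [lorentz, Pi.add_apply, Pi.smul_apply, smul_eq_mul] at *
    linear_combination hv + μ ^ 2 * hn + 2 * μ * hvn
  simp only [cubicDefect, hv, e1, e2, smul_eq_mul, Pi.add_apply, Pi.smul_apply] at h0 h1 h2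
  simp only [lorentz] at hv hn hvn
  obtain ⟨a, ha⟩ : ∃ a, a = v 1 := ⟨_, rfl⟩
  obtain ⟨b, hb⟩ : ∃ b, b = v 2 - v 0 := ⟨_, rfl⟩
  obtain ⟨c, hc⟩ : ∃ c, c = v 0 + v 2 := ⟨_, rfl⟩
  obtain ⟨α, hα⟩ : ∃ a, a = n 1 := ⟨_, rfl⟩
  obtain ⟨β, hβ⟩ : ∃ b, b = n 2 - n 0 := ⟨_, rfl⟩
  obtain ⟨γ, hγ⟩ : ∃ c, c = n 0 + n 2 := ⟨_, rfl⟩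
  have hv' : a ^ 2 + b * c = 1 := by rw [ha, hb, hc]; linear_combination hv
  have hn' : α ^ 2 + β * γ = 0 := by rw [hα, hβ, hγ]; linear_combination hn
  have hvn' : 2 * a * α + b * γ + c * β = 0 := by
    rw [ha, hb, hc, hα, hβ, hγ]; linear_combination 2 * hvn
  have hne : ¬ (α = 0 ∧ β = 0 ∧ γ = 0) := by
    rintro ⟨x, y, z⟩
    apply hn0
    ext i
    fin_cases i
    · change n 0 = 0; linarith
    · change n 1 = 0; linarith
    · change n 2 = 0; linarith
  -- the coefficients of the defect as a quadratic polynomial along the pencil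
  have F2 : ∀ s t : ℝ, 3 * (α * s + β * t) ^ 2 * s * c₀
      + ((α * s + β * t) ^ 2 * t + 2 * (α * s + β * t) * (γ * s - α * t) * s) * c₁
      + ((γ * s - α * t) ^ 2 * s + 2 * (α * s + β * t) * (γ * s - α * t) * t) * c₂
      + 3 * (γ * s - α * t) ^ 2 * t * c₃ = 0 := by
    intro s t
    rw [hα, hβ, hγ]
    -- A quadratic polynomial `f` satisfies `f(μ) - μ f(1) - (1 - μ) f(0) = μ (μ - 1) f₂`, with `f₂`
    -- its leading coefficient; the three zeros `0`, `1`, `μ` are distinct.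
    have : μ * (μ - 1) ≠ 0 := mul_ne_zero hμ0 (sub_ne_zero.mpr hμ1)
    refine (mul_eq_zero.mp ?_).resolve_left this
    linear_combination h2 s t - μ * h1 s t - (1 - μ) * h0 s t
  have F1 : ∀ s t : ℝ, 6 * (α * s + β * t) * (a * s + b * t) * s * c₀
      + 2 * ((α * s + β * t) * (a * s + b * t) * t + ((α * s + β * t) * (c * s - a * t)
        + (a * s + b * t) * (γ * s - α * t)) * s) * c₁
      + 2 * ((γ * s - α * t) * (c * s - a * t) * s + ((α * s + β * t) * (c * s - a * t)
        + (a * s + b * t) * (γ * s - α * t)) * t) * c₂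
      + 6 * (γ * s - α * t) * (c * s - a * t) * t * c₃ = 0 := by
    intro s t
    have := F2 s t
    rw [hα, hβ, hγ] at this ⊢
    rw [ha, hb, hc]
    linear_combination h1 s t - h0 s t - this
  have F0 : ∀ s t : ℝ, (3 * (a * s + b * t) ^ 2 * s + s ^ 3) * c₀
      + ((a * s + b * t) ^ 2 * t + 2 * (a * s + b * t) * (c * s - a * t) * s + s ^ 2 * t) * c₁
      + ((c * s - a * t) ^ 2 * s + 2 * (a * s + b * t) * (c * s - a * t) * t + s * t ^ 2) * c₂
      + (3 * (c * s - a * t) ^ 2 * t + t ^ 3) * c₃ = 0 := by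
    intro s t
    rw [ha, hb, hc]
    linear_combination h0 s t
  clear h0 h1 h2
  -- The nilpotent matrix of `n` has a line as image, spanned by `x = (1, 0)` if `γ = 0` and by `x =
  -- (r, 1)` with `r = α / γ` otherwise. In both cases `F2` says that `x` is a double root of the
  -- cubic, `F1` that it is a triple root, and `F0` kills the remaining coefficient.
  by_cases hγ0 : γ = 0
  · subst hγ0
    have hα0 : α = 0 := by nlinarith
    subst hα0
    have hβ0 : β ≠ 0 := fun h => hne ⟨rfl, h, rfl⟩
    have hc0 : c = 0 := by
      refine (mul_eq_zero.mp ?_).resolve_right hβ0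
      linear_combination hvn'
    subst hc0
    have hc1 : c₁ = 0 := by
      refine (mul_eq_zero.mp ?_).resolve_left (pow_ne_zero 2 hβ0)
      linear_combination F2 0 1
    subst hc1
    have hc00 : c₀ = 0 := by
      refine (mul_eq_zero.mp ?_).resolve_left (pow_ne_zero 2 hβ0)
      linear_combination F2 1 1 / 3
    subst hc00
    have hc2 : c₂ = 0 := by
      refine (mul_eq_zero.mp ?_).resolve_left hβ0
      linear_combination (-a / 2) * F1 0 1 - β * c₂ * hv'
    subst hc2
    refine ⟨rfl, rfl, rfl, ?_⟩
    linear_combination F0 0 1 / 4 - 3 / 4 * c₃ * hv'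
  · obtain ⟨r, hr⟩ : ∃ r, α = γ * r := ⟨α / γ, by field_simp⟩
    have hβ' : β = - r ^ 2 * γ := by
      refine mul_left_cancel₀ hγ0 ?_
      rw [hr] at hn'
      linear_combination hn'
    have hb' : b = c * r ^ 2 - 2 * a * r := by
      refine mul_left_cancel₀ hγ0 ?_
      rw [hr, hβ'] at hvn'
      linear_combination hvn'
    rw [hb'] at hv'
    simp only [hr, hβ', hb'] at F2 F1 F0
    have g2 : γ ^ 2 ≠ 0 := pow_ne_zero 2 hγ0
    have k1 : 3 * r ^ 2 * c₀ + 2 * r * c₁ + c₂ = 0 := by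
      refine (mul_eq_zero.mp ?_).resolve_left g2
      linear_combination F2 1 0
    have k2 : r ^ 2 * c₁ + 2 * r * c₂ + 3 * c₃ = 0 := by
      refine (mul_eq_zero.mp ?_).resolve_left g2
      linear_combination (F2 1 1 - F2 1 (-1)) / 2 - F2 0 1 + 2 * r * γ ^ 2 * k1
    have k3 : c₁ = -3 * r * c₀ := by
      have : γ * (a - c * r) * (c₁ + 3 * r * c₀) = 0 := by
        linear_combination F1 1 0 / 2 - γ * c * k1
      -- Orthogonality of `v` and `n` makes `x = (r, 1)` an eigenvector of the matrix of `v`, with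
      -- eigenvalue `c r - a`, whose square is `⟨v, v⟩ = 1`.
      have h3 : a - c * r ≠ 0 := by
        intro h
        have : (a - c * r) ^ 2 = 1 := by linear_combination hv'
        rw [h] at this
        norm_num at this
      have := (mul_eq_zero.mp this).resolve_left (mul_ne_zero hγ0 h3)
      linarith
    have k0 : c₀ = 0 := by
      linear_combination F0 1 0 / 4 - a * c / 2 * k3 - c ^ 2 / 4 * k1 + c ^ 2 * r / 2 * k3
        - 3 / 4 * c₀ * hv'
    rw [k0] at k3 k1
    have k4 : c₁ = 0 := by linarith
    rw [k4] at k1 k2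
    have k5 : c₂ = 0 := by linarith
    rw [k5] at k2
    exact ⟨k0, k4, k5, by linarith⟩

theorem cubicDefect_smul_of_sq {v : Fin 3 → ℝ} {σ : ℝ} (hσ : σ ^ 2 = 1) (c₀ c₁ c₂ c₃ s t : ℝ) :
    cubicDefect (σ • v) c₀ c₁ c₂ c₃ s t = cubicDefect v c₀ c₁ c₂ c₃ s t := by
  have : cubicDefect (σ • v) c₀ c₁ c₂ c₃ s t = σ ^ 2 * cubicDefect v c₀ c₁ c₂ c₃ s t := by
    simp only [cubicDefect, lorentz, Pi.smul_apply, smul_eq_mul]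
    ring
  rw [this, hσ, one_mul]

/-- Degeneracy makes `σ = ⟨v, w⟩` and `ρ = ⟨v, u⟩` equal to `±1`, so `n = σ w - v` is null and
orthogonal to `v`. As the defect is quadratic in the matrix, `w` and `u` may be replaced by `σ w = v
+ n` and `ρ u = v + μ n`, three members of a null pencil. -/
theorem determinesCubics_of_degenerate {S : Set (Fin 3 → ℝ)} {v w u : Fin 3 → ℝ} (hv : v ∈ S)
    (hw : w ∈ S) (hu : u ∈ S) (hvv : lorentz v v = 1) (hww : lorentz w w = 1)
    (hvw : lorentz v w ^ 2 = 1) (hvu : lorentz v u ^ 2 = 1)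
    (ivw : LinearIndependent ℝ ![v, w]) (ivu : LinearIndependent ℝ ![v, u])
    (iwu : LinearIndependent ℝ ![w, u]) (hdep : ¬ LinearIndependent ℝ ![v, w, u]) :
    DeterminesCubics S := by
  intro c₀ c₁ c₂ c₃ h
  rw [LinearIndependent.pair_iff] at ivw ivu iwu
  obtain ⟨σ, hσ⟩ : ∃ σ, σ = lorentz v w := ⟨_, rfl⟩
  obtain ⟨ρ, hρ⟩ : ∃ ρ, ρ = lorentz v u := ⟨_, rfl⟩
  rw [← hσ] at hvw
  rw [← hρ] at hvu
  rw [Fintype.not_linearIndependent_iff] at hdep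
  obtain ⟨g, hg, i, hi⟩ := hdep
  simp only [Fin.sum_univ_three, Matrix.cons_val_zero, Matrix.cons_val_one, Matrix.cons_val] at hg
  have hsum : g 0 + g 1 * σ + g 2 * ρ = 0 := by
    have : lorentz v (g 0 • v + g 1 • w + g 2 • u) = 0 := by rw [hg]; simp [lorentz]
    simp only [lorentz, Pi.add_apply, Pi.smul_apply, smul_eq_mul] at this hσ hρ hvv
    linear_combination this - g 0 * hvv + g 1 * hσ + g 2 * hρ
  have hσ0 : σ ≠ 0 := by rintro rfl; norm_num at hvw
  have hρ0 : ρ ≠ 0 := by rintro rfl; norm_num at hvu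
  have h2 : g 2 ≠ 0 := by
    intro h2
    rw [h2, zero_smul, add_zero] at hg
    have := ivw _ _ hg
    fin_cases i
    · exact hi this.1
    · exact hi this.2
    · exact hi h2
  have h1 : g 1 ≠ 0 := by
    intro h1
    rw [h1, zero_smul, add_zero] at hg
    exact h2 (ivu _ _ hg).2
  have h0 : g 0 ≠ 0 := by
    intro h0
    rw [h0, zero_smul, zero_add] at hg
    exact h2 (iwu _ _ hg).2
  -- The parameter comes from solving the dependence relation for `u`, with `g 0` eliminated by
  -- pairing that relation with `v`. It is nonzero because `g 1 ≠ 0` and differs from `1` because `g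
  -- 0 ≠ 0`.
  have hu' : ρ • u = v + (-(g 1 * σ) / (g 2 * ρ)) • (σ • w - v) := by
    have hl : u = -(g 0 / g 2) • v - (g 1 / g 2) • w := by
      ext j
      have := congrFun hg j
      simp only [Pi.add_apply, Pi.smul_apply, smul_eq_mul, Pi.zero_apply] at this
      simp only [Pi.sub_apply, Pi.smul_apply, Pi.neg_apply, neg_smul, smul_eq_mul]
      field_simp
      linear_combination this
    rw [hl, eq_neg_of_add_eq_zero_left (a := g 0) (b := g 1 * σ + g 2 * ρ) (by linarith)]
    have hρ' : ρ * ρ = 1 := by rw [← hvu]; ring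
    have hσ' : σ * σ = 1 := by rw [← hvw]; ring
    have hri : ρ = 1 / ρ := by field_simp; linarith
    ext j
    simp only [Pi.smul_apply, Pi.add_apply, Pi.sub_apply, smul_eq_mul]
    field_simp
    linear_combination ((g 1 * σ + g 2 * ρ) * v j - g 1 * w j) * hvu + g 1 * w j * hvw
  refine eq_zero_of_cubicDefect_pencil (v := v) (n := σ • w - v) (μ := -(g 1 * σ) / (g 2 * ρ))
    hvv ?_ ?_ ?_ ?_ ?_ (h v hv) ?_ ?_
  · simp only [lorentz, Pi.sub_apply, Pi.smul_apply, smul_eq_mul] at *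
    linear_combination σ ^ 2 * hww + hvv + 2 * σ * hσ - hvw
  · simp only [lorentz, Pi.sub_apply, Pi.smul_apply, smul_eq_mul] at *
    linear_combination - σ * hσ - hvv + hvw
  · intro hz
    have := ivw (-1) σ (by rw [← hz]; module)
    exact hσ0 this.2
  · exact div_ne_zero (neg_ne_zero.mpr (mul_ne_zero h1 hσ0)) (mul_ne_zero h2 hρ0)
  · intro hz
    rw [div_eq_one_iff_eq (mul_ne_zero h2 hρ0)] at hz
    exact h0 (by linarith)
  · intro s t
    rw [add_sub_cancel, cubicDefect_smul_of_sq hvw]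
    exact h w hw s t
  · intro s t
    rw [← hu', cubicDefect_smul_of_sq hvu]
    exact h u hu s t

end Cubic

end ParaQuat
end

noncomputable section

namespace ParaQuat

/-! ### The torsion equation in the model `E × E = E ⊗ ℝ²`. -/

section Model

variable {E : Type*} [NormedAddCommGroup E] [NormedSpace ℝ E]

variable (E) in
/-- The endomorphism of `E × E` given by the traceless matrix `v₀ J₁ + v₁ J₂ + v₂ J₃`, where
`J₁ (x, y) = (-y, x)`, `J₂ (x, y) = (x, -y)` and `J₃ (x, y) = (y, x)`. -/
def modelEnd : (Fin 3 → ℝ) →ₗ[ℝ] (E × E →L[ℝ] E × E) where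
  toFun v := (v 1 • ContinuousLinearMap.fst ℝ E E + (v 2 - v 0) • ContinuousLinearMap.snd ℝ E E).prod
    ((v 0 + v 2) • ContinuousLinearMap.fst ℝ E E - v 1 • ContinuousLinearMap.snd ℝ E E)
  map_add' v w := by
    ext x <;> simp <;> module
  map_smul' c v := by
    ext x <;> simp <;> module

theorem modelEnd_apply (v : Fin 3 → ℝ) (x y : E) :
    modelEnd E v (x, y) = (v 1 • x + (v 2 - v 0) • y, (v 0 + v 2) • x - v 1 • y) := rfl

theorem modelEnd_apply_smul (v : Fin 3 → ℝ) (s t : ℝ) (e : E) :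
    modelEnd E v (s • e, t • e) =
      ((v 1 * s + (v 2 - v 0) * t) • e, ((v 0 + v 2) * s - v 1 * t) • e) := by
  rw [modelEnd_apply]
  ext <;> simp only <;> module

theorem modelEnd_mul_self (v : Fin 3 → ℝ) : modelEnd E v * modelEnd E v = lorentz v v • 1 := by
  refine ContinuousLinearMap.ext fun x => ?_
  change modelEnd E v (modelEnd E v (x.1, x.2)) = lorentz v v • (x.1, x.2)
  rw [modelEnd_apply, modelEnd_apply, lorentz]
  ext <;> simp <;> module

variable (E) in
/-- The bilinear maps `B` such that every `B X` normalizes the space of traceless matrices. -/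
def normalizerForms : Submodule ℝ (E × E →L[ℝ] E × E →L[ℝ] E × E) where
  carrier := {B | ∀ X v, B X * modelEnd E v - modelEnd E v * B X ∈ LinearMap.range (modelEnd E)}
  add_mem' {B C} hB hC X v := by
    have := add_mem (hB X v) (hC X v)
    convert this using 1
    simp only [add_apply, add_mul, mul_add]
    abel
  zero_mem' X v := by simp
  smul_mem' c B hB X v := by
    have := Submodule.smul_mem _ c (hB X v)
    convert this using 1
    simp only [FunLike.coe_smul, Pi.smul_apply, smul_mul_assoc, mul_smul_comm, smul_sub]

variable (E) in
/-- The alternating bilinear maps of the form `α ∧ Id`. -/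
def traceForms : Submodule ℝ (E → E → E) where
  carrier := {g | ∃ α : E →ₗ[ℝ] ℝ, ∀ e f, g e f = α e • f - α f • e}
  add_mem' := by
    rintro g g' ⟨α, h⟩ ⟨α', h'⟩
    refine ⟨α + α', fun e f => ?_⟩
    simp only [Pi.add_apply, h, h', LinearMap.add_apply]
    module
  zero_mem' := ⟨0, fun e f => by simp⟩
  smul_mem' := by
    rintro c g ⟨α, h⟩
    refine ⟨c • α, fun e f => ?_⟩
    simp only [Pi.smul_apply, h, LinearMap.smul_apply, smul_eq_mul]
    module

variable (T : E × E →L[ℝ] E × E →L[ℝ] E × E)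

/-- The condition on the torsion `T` of a connection for which the matrices are parallel, imposed by
the vanishing of the Nijenhuis tensor of an endomorphism with matrix `v` and covariant derivative
`φ`. -/
def NijenhuisCondition (v : Fin 3 → ℝ) : Prop :=
  ∃ φ : E × E →ₗ[ℝ] (Fin 3 → ℝ), ∀ X Y,
    lorentz v v • T X Y + T (modelEnd E v X) (modelEnd E v Y)
        - modelEnd E v (T (modelEnd E v X) Y) - modelEnd E v (T X (modelEnd E v Y)) =
      modelEnd E (φ (modelEnd E v X)) Y - modelEnd E (φ (modelEnd E v Y)) X
        - modelEnd E v (modelEnd E (φ X) Y) + modelEnd E v (modelEnd E (φ Y) X)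

theorem bilin_expand (p q p' q' : ℝ) (e f : E) :
    T (p • e, q • e) (p' • f, q' • f) = (p * p') • T (e, 0) (f, 0) + (p * q') • T (e, 0) (0, f)
      + (q * p') • T (0, e) (f, 0) + (q * q') • T (0, e) (0, f) := by
  have h1 : ((p • e, q • e) : E × E) = p • (e, (0 : E)) + q • ((0 : E), e) := by simp
  have h2 : ((p' • f, q' • f) : E × E) = p' • (f, (0 : E)) + q' • ((0 : E), f) := by simp
  rw [h1, h2]
  simp only [map_add, map_smul, add_apply, FunLike.coe_smul, Pi.smul_apply]
  module

/-- The coefficients of the cubic `ω(h, T (e ⊗ h, f ⊗ h))` in `h`. -/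
def torsionCubic : Fin 4 → E → E → E :=
  ![fun e f => (T (e, 0) (f, 0)).2,
    fun e f => (T (e, 0) (0, f)).2 + (T (0, e) (f, 0)).2 - (T (e, 0) (f, 0)).1,
    fun e f => (T (0, e) (0, f)).2 - (T (e, 0) (0, f)).1 - (T (0, e) (f, 0)).1,
    fun e f => -(T (0, e) (0, f)).1]

variable {T}

/-- Evaluate the condition at `e ⊗ h`, `f ⊗ h` and pair with `h` under `ω`. Since `ω(h, A z) = -ω(A
h, z)`, the left side becomes the polarized cubic `3 c(Ah, Ah, h) + ⟨v, v⟩ c(h, h, h)`. The terms in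
`φ` act on the factor `ℝ²` only, so each contributes a scalar depending on `e` times `f`, or the
reverse, that is, a form `α ∧ Id`. -/
theorem NijenhuisCondition.cubicDefect_mem {v : Fin 3 → ℝ} (h : NijenhuisCondition T v) (s t : ℝ) :
    cubicDefect v (torsionCubic T 0) (torsionCubic T 1) (torsionCubic T 2) (torsionCubic T 3) s t
      ∈ traceForms E := by
  obtain ⟨φ, h⟩ := h
  obtain ⟨k, hk⟩ : ∃ k, k = v 1 * s + (v 2 - v 0) * t := ⟨_, rfl⟩
  obtain ⟨l, hl⟩ : ∃ l, l = (v 0 + v 2) * s - v 1 * t := ⟨_, rfl⟩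
  let ψ (p q : ℝ) : E →ₗ[ℝ] (Fin 3 → ℝ) :=
    φ ∘ₗ (p • LinearMap.inl ℝ E E + q • LinearMap.inr ℝ E E)
  have hψ (p q : ℝ) (e : E) : ψ p q e = φ (p • e, q • e) := by simp [ψ]
  let pr (i : Fin 3) : (Fin 3 → ℝ) →ₗ[ℝ] ℝ := LinearMap.proj i
  refine ⟨s • ((s • (pr 0 + pr 2) - t • pr 1) ∘ₗ ψ k l) - t • ((s • pr 1 + t • (pr 2 - pr 0)) ∘ₗ ψ k l)
    + k • ((s • (pr 0 + pr 2) - t • pr 1) ∘ₗ ψ s t) - l • ((s • pr 1 + t • (pr 2 - pr 0)) ∘ₗ ψ s t),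
    fun e f => ?_⟩
  have key := h (s • e, t • e) (s • f, t • f)
  simp only [modelEnd_apply_smul, ← hk, ← hl, bilin_expand] at key
  obtain ⟨P00, hP00⟩ : ∃ P, P = T (e, 0) (f, 0) := ⟨_, rfl⟩
  obtain ⟨P01, hP01⟩ : ∃ P, P = T (e, 0) (0, f) := ⟨_, rfl⟩
  obtain ⟨P10, hP10⟩ : ∃ P, P = T (0, e) (f, 0) := ⟨_, rfl⟩
  obtain ⟨P11, hP11⟩ : ∃ P, P = T (0, e) (0, f) := ⟨_, rfl⟩
  simp only [torsionCubic, cubicDefect, ← hk, ← hl, Pi.add_apply, Pi.smul_apply, Matrix.cons_val,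
    LinearMap.add_apply, LinearMap.sub_apply, LinearMap.smul_apply, LinearMap.comp_apply, hψ,
    LinearMap.proj_apply, smul_eq_mul, pr]
  simp only [← hP00, ← hP01, ← hP10, ← hP11] at key ⊢
  clear hP00 hP01 hP10 hP11 hψ
  obtain ⟨a, b⟩ := P00
  obtain ⟨c, d⟩ := P01
  obtain ⟨a', b'⟩ := P10
  obtain ⟨c', d'⟩ := P11
  simp only [Prod.smul_mk, Prod.mk_add_mk, modelEnd_apply, Prod.mk_sub_mk, Prod.mk.injEq] at key
  obtain ⟨k1, k2⟩ := key
  linear_combination (norm := skip) s • k2 - t • k1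
  rw [hk, hl]
  module

/-- Linear functionals on the quotient by `traceForms E` separate its points, and each turns the
vector-valued cubic into a real one with vanishing defect. -/
theorem mem_traceForms_of_determinesCubics {S : Set (Fin 3 → ℝ)} (hS : DeterminesCubics S)
    (h : ∀ v ∈ S, NijenhuisCondition T v) (i : Fin 4) : torsionCubic T i ∈ traceForms E := by
  rw [← Submodule.Quotient.mk_eq_zero, ← Module.forall_dual_apply_eq_zero_iff ℝ]
  intro ℓ
  let q : (E → E → E) →ₗ[ℝ] ℝ := ℓ ∘ₗ (traceForms E).mkQ
  have := hS (q (torsionCubic T 0)) (q (torsionCubic T 1)) (q (torsionCubic T 2))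
    (q (torsionCubic T 3)) fun v hv s t => by
      have h1 := (h v hv).cubicDefect_mem s t
      have h2 : q (cubicDefect v (torsionCubic T 0) (torsionCubic T 1) (torsionCubic T 2)
          (torsionCubic T 3) s t) = 0 := by
        change ℓ (Submodule.Quotient.mk _) = 0
        rw [(Submodule.Quotient.mk_eq_zero _).mpr h1, map_zero]
      rw [← h2]
      simp only [cubicDefect, map_add, map_smul]
  obtain ⟨h0, h1, h2, h3⟩ := this
  fin_cases i <;> assumption

variable [FiniteDimensional ℝ E]

/-- The torsion is the alternation of a bilinear map with values in the normalizer. -/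
theorem exists_normalizerForm {S : Set (Fin 3 → ℝ)} (hS : DeterminesCubics S)
    (h : ∀ v ∈ S, NijenhuisCondition T v) (hT : ∀ X Y, T X Y = -T Y X) :
    ∃ B ∈ normalizerForms E, ∀ X Y, B X Y - B Y X = T X Y := by
  obtain ⟨α0, h0⟩ := mem_traceForms_of_determinesCubics hS h 0
  obtain ⟨α1, h1⟩ := mem_traceForms_of_determinesCubics hS h 1
  obtain ⟨α2, h2⟩ := mem_traceForms_of_determinesCubics hS h 2
  obtain ⟨α3, h3⟩ := mem_traceForms_of_determinesCubics hS h 3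
  simp only [torsionCubic, Matrix.cons_val] at h0 h1 h2 h3
  -- `b X` is `D X ∈ gl(E)` acting diagonally, plus a scalar `2 × 2` matrix acting on `ℝ²`, so it
  -- normalizes `sl(2)`. `D` is chosen so that the skew-symmetrization of `b` has the mixed
  -- components of `T`; the forms `αᵢ` then account for `T` on `E × 0` and on `0 × E`.
  let D (X : E × E) (y : E) : E := (T (X.1, 0) (0, y)).2 - α1 X.1 • y - (T (y, 0) (0, X.2)).1
  let b (X Y : E × E) : E × E := (D X Y.1 - α3 X.2 • Y.2,
    D X Y.2 + α0 X.1 • Y.1 + α1 X.1 • Y.2 + α2 X.2 • Y.2)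
  have hl (x y : E) : ((x + y, 0) : E × E) = (x, 0) + (y, 0) := by simp
  have hr (x y : E) : ((0, x + y) : E × E) = (0, x) + (0, y) := by simp
  have hsl (c : ℝ) (x : E) : ((c • x, 0) : E × E) = c • (x, 0) := by simp
  have hsr (c : ℝ) (x : E) : ((0, c • x) : E × E) = c • (0, x) := by simp
  have hD1 (X X' : E × E) (y : E) : D (X + X') y = D X y + D X' y := by
    simp only [D, Prod.fst_add, Prod.snd_add, hl, hr, map_add, add_apply]
    module
  have hD2 (X : E × E) (y y' : E) : D X (y + y') = D X y + D X y' := by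
    simp only [D, Prod.fst_add, Prod.snd_add, hl, hr, map_add, add_apply]
    module
  have hD3 (c : ℝ) (X : E × E) (y : E) : D (c • X) y = c • D X y := by
    simp only [D, Prod.smul_fst, Prod.smul_snd, hsl, hsr, map_smul, FunLike.coe_smul,
      Pi.smul_apply, smul_eq_mul]
    module
  have hD4 (c : ℝ) (X : E × E) (y : E) : D X (c • y) = c • D X y := by
    simp only [D, Prod.smul_fst, Prod.smul_snd, hsl, hsr, map_smul, FunLike.coe_smul,
      Pi.smul_apply]
    module
  have hb : IsBilinearMap ℝ b :=
  { add_left X X' Y := by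
      ext <;> simp only [b, hD1, Prod.fst_add, Prod.snd_add, map_add] <;> module
    smul_left c X Y := by
      ext <;> simp only [b, hD3, Prod.smul_fst, Prod.smul_snd, map_smul, smul_eq_mul] <;> module
    add_right X Y Y' := by
      ext <;> simp only [b, hD2, Prod.fst_add, Prod.snd_add] <;> module
    smul_right c X Y := by
      ext <;> simp only [b, hD4, Prod.smul_fst, Prod.smul_snd] <;> module }
  refine ⟨hb.toLinearMap.toContinuousBilinearMap, ?_, ?_⟩
  · intro X v
    let a := v 1
    let d := v 2 - v 0
    let c := v 0 + v 2
    let δ := α1 X.1 + α2 X.2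
    let p := 2 * a * α3 X.2 - d * δ
    let q := 2 * a * α0 X.1 + c * δ
    -- The diagonal part drops out. These are the coefficients of the commutator of `[[0, -α3 X.2],
    -- [α0 X.1, δ]]` with `[[a, d], [c, -a]]`, whose off-diagonal entries are `p` and `q`.
    refine ⟨![(q - p) / 2, -(α3 X.2 * c + d * α0 X.1), (q + p) / 2], ?_⟩
    refine ContinuousLinearMap.ext fun Y => ?_
    change _ = b X (modelEnd E v (Y.1, Y.2)) - modelEnd E v (b X Y)
    change modelEnd E _ (Y.1, Y.2) = _
    simp only [b, modelEnd_apply, Matrix.cons_val, hD2, hD4, sub_eq_add_neg, ← neg_smul]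
    ext
    · simp only [Prod.fst_add, Prod.fst_neg, p, q, δ, a, c, d]
      module
    · simp only [Prod.snd_add, Prod.snd_neg, p, q, δ, a, c, d]
      module
  · rintro ⟨x0, x1⟩ ⟨y0, y1⟩
    change b _ _ - b _ _ = _
    have e1 : ((x0, x1) : E × E) = (x0, 0) + (0, x1) := by simp
    have e2 : ((y0, y1) : E × E) = (y0, 0) + (0, y1) := by simp
    have hexp : T (x0, x1) (y0, y1) = T (x0, 0) (y0, 0) + T (x0, 0) (0, y1)
        + T (0, x1) (y0, 0) + T (0, x1) (0, y1) := by
      rw [e1, e2]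
      simp only [map_add, add_apply]
      abel
    rw [hexp]
    clear e1 e2 hexp
    have s1 := hT (0, x1) (y0, 0)
    have s2 := hT (0, y1) (x0, 0)
    have g0 := h0 x0 y0
    have g1 := h1 x0 y0
    have g2 := h2 x1 y1
    have g3 := h3 x1 y1
    rw [hT (0, x0) (y0, 0)] at g1
    rw [hT (0, x1) (y1, 0)] at g2
    rw [s1]
    ext
    · simp only [b, D, Prod.fst_sub, Prod.fst_add, Prod.fst_neg, Prod.snd_neg] at g0 g1 g2 g3 ⊢
      linear_combination (norm := module) g1 + g3
    · simp only [b, D, Prod.snd_sub, Prod.snd_add, Prod.fst_neg, Prod.snd_neg] at g0 g1 g2 g3 ⊢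
      linear_combination (norm := module) -g0 - g2
end Model

end ParaQuat
end

noncomputable section

namespace ParaQuat

/-! ### Derivatives and smoothness of vector-valued and operator-valued maps. -/

section Calculus

variable {n : ℕ} {M : Type*} [TopologicalSpace M] [ChartedSpace (EuclideanSpace ℝ (Fin n)) M]
  {V : Type*} [NormedAddCommGroup V] [NormedSpace ℝ V]
  {W : Type*} [NormedAddCommGroup W] [NormedSpace ℝ W]

theorem mvfderiv_clm_apply {A : M → V →L[ℝ] W} {s : M → V} {x : M}
    (hA : MDifferentiableAt (𝓡 n) 𝓘(ℝ, V →L[ℝ] W) A x) (hs : MDifferentiableAt (𝓡 n) 𝓘(ℝ, V) s x)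
    (v : TangentSpace (𝓡 n) x) :
    mvfderiv (𝓡 n) (fun y => A y (s y)) x v =
      mvfderiv (𝓡 n) A x v (s x) + A x (mvfderiv (𝓡 n) s x v) := by
  let A' : EuclideanSpace ℝ (Fin n) →L[ℝ] (V →L[ℝ] W) := mvfderiv (𝓡 n) A x
  let s' : EuclideanSpace ℝ (Fin n) →L[ℝ] V := mvfderiv (𝓡 n) s x
  have h1 : HasMFDerivAt (𝓡 n) 𝓘(ℝ, V →L[ℝ] W) A x A' := hA.hasMFDerivAt
  have h2 : HasMFDerivAt (𝓡 n) 𝓘(ℝ, V) s x s' := hs.hasMFDerivAt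
  have h3 : HasMFDerivAt (𝓡 n) 𝓘(ℝ, W) (fun y => A y (s y)) x
      ((A x).comp s' + A'.flip (s x)) := by
    refine ⟨h1.1.clm_apply h2.1, ?_⟩
    have h4 := HasFDerivWithinAt.clm_apply h1.2 h2.2
    simp only [writtenInExtChartAt, Function.comp_apply, mfld_simps] at h4 ⊢
    exact h4
  change mfderiv (𝓡 n) 𝓘(ℝ, W) (fun y => A y (s y)) x v = _
  rw [h3.mfderiv, add_comm]
  rfl

theorem mvfderiv_clm_const_apply (A : V →L[ℝ] W) {s : M → V} {x : M}
    (hs : MDifferentiableAt (𝓡 n) 𝓘(ℝ, V) s x) (v : TangentSpace (𝓡 n) x) :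
    mvfderiv (𝓡 n) (fun y => A (s y)) x v = A (mvfderiv (𝓡 n) s x v) := by
  have := mvfderiv_clm_apply (A := fun _ : M => A) mdifferentiableAt_const hs v
  rw [this, mvfderiv_const]
  simp

/-- A derivative outside `S` would be detected by a linear functional vanishing on `S`, whose
composition with `f` is locally zero. -/
theorem mvfderiv_mem [FiniteDimensional ℝ W] (S : Submodule ℝ W) {f : M → W} {x : M}
    (hf : MDifferentiableAt (𝓡 n) 𝓘(ℝ, W) f x) (hS : ∀ᶠ y in nhds x, f y ∈ S)
    (v : TangentSpace (𝓡 n) x) : mvfderiv (𝓡 n) f x v ∈ S := by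
  by_contra h
  obtain ⟨ℓ, hl, hle⟩ := Submodule.exists_le_ker_of_notMem h
  have h1 := mvfderiv_clm_const_apply (LinearMap.toContinuousLinearMap ℓ) hf v
  have h2 : (fun y => LinearMap.toContinuousLinearMap ℓ (f y)) =ᶠ[nhds x] fun _ => (0 : ℝ) := by
    filter_upwards [hS] with y hy using hle hy
  have h3 : mvfderiv (𝓡 n) (fun y => LinearMap.toContinuousLinearMap ℓ (f y)) x v = 0 := by
    change mfderiv (𝓡 n) 𝓘(ℝ, ℝ) _ x v = 0
    rw [h2.mfderiv_eq, mfderiv_const]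
    rfl
  rw [h3] at h1
  exact hl h1.symm

theorem contMDiffAt_linearMap_comp [FiniteDimensional ℝ V] (R : V →ₗ[ℝ] W) {f : M → V} {x : M}
    {k : ℕ∞ω} (hf : ContMDiffAt (𝓡 n) 𝓘(ℝ, V) k f x) :
    ContMDiffAt (𝓡 n) 𝓘(ℝ, W) k (fun y => R (f y)) x :=
  (LinearMap.toContinuousLinearMap R).contMDiff.contMDiffAt.comp x hf

theorem contMDiffAt_clm_of_forall_apply [FiniteDimensional ℝ V] {k : ℕ∞ω} {A : M → V →L[ℝ] W}
    {x : M} (h : ∀ v, ContMDiffAt (𝓡 n) 𝓘(ℝ, W) k (fun y => A y v) x) :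
    ContMDiffAt (𝓡 n) 𝓘(ℝ, V →L[ℝ] W) k A x := by
  let b := Module.finBasis ℝ V
  have hA : A = fun y => ∑ i, ContinuousLinearMap.smulRightL ℝ V W
      (LinearMap.toContinuousLinearMap (b.coord i)) (A y (b i)) := by
    ext y v
    simp only [sum_apply, ContinuousLinearMap.smulRightL_apply_apply]
    conv_lhs => rw [← b.sum_repr v, map_sum]
    simp
  rw [hA]
  refine ContMDiffAt.sum fun i _ => ?_
  exact (ContinuousLinearMap.contMDiff _).contMDiffAt.comp x (h (b i))

variable [IsManifold (𝓡 n) ∞ M]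

theorem contMDiffAt_mvfderiv_apply {s : M → V} {X : VField n M} {x : M}
    (hs : ContMDiffAt (𝓡 n) 𝓘(ℝ, V) ∞ s x)
    (hX : ContMDiffAt (𝓡 n) (𝓡 n).tangent ∞
      (fun x => (⟨x, X x⟩ : TangentBundle (𝓡 n) M)) x) :
    ContMDiffAt (𝓡 n) 𝓘(ℝ, V) ∞ (fun y => mvfderiv (𝓡 n) s y (X y)) x := by
  have h1 := hs.mfderiv_const (m := ∞) (by simp)
  have h2 := ContMDiffAt.clm_apply_of_inCoordinates (b₁ := id) (b₂ := s) h1 hX hs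
  have h3 := (Bundle.contMDiffAt_totalSpace.1 h2).2
  refine h3.congr_of_eventuallyEq (Filter.Eventually.of_forall fun y => ?_)
  simp [mvfderiv]
  rfl

/-- Taking for `X` the constant sections of the trivialization at `x` reduces smoothness of `L` to
that of its columns. -/
theorem contMDiffAt_hom_of_forall_apply
    {L : ∀ x : M, TangentSpace (𝓡 n) x →L[ℝ] TangentSpace (𝓡 n) x} {x : M}
    (h : ∀ X : VField n M, ContMDiffAt (𝓡 n) (𝓡 n).tangent ∞
        (fun x => (⟨x, X x⟩ : TangentBundle (𝓡 n) M)) x →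
      ContMDiffAt (𝓡 n) (𝓡 n).tangent ∞
        (fun x => (⟨x, L x (X x)⟩ : TangentBundle (𝓡 n) M)) x) :
    ContMDiffAt (𝓡 n)
      ((𝓡 n).prod 𝓘(ℝ, EuclideanSpace ℝ (Fin n) →L[ℝ] EuclideanSpace ℝ (Fin n))) ∞
      (fun x => (⟨x, L x⟩ :
        Bundle.TotalSpace (EuclideanSpace ℝ (Fin n) →L[ℝ] EuclideanSpace ℝ (Fin n))
        (fun x : M => TangentSpace (𝓡 n) x →L[ℝ] TangentSpace (𝓡 n) x))) x := by
  rw [contMDiffAt_hom_bundle]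
  refine ⟨contMDiffAt_id, contMDiffAt_clm_of_forall_apply fun v => ?_⟩
  have h1 := h (fun y => (trivializationAt (EuclideanSpace ℝ (Fin n)) (TangentSpace (𝓡 n)) x).symm
    y v) ?_
  · refine (Bundle.contMDiffAt_totalSpace.1 h1).2.congr_of_eventuallyEq ?_
    filter_upwards [(trivializationAt (EuclideanSpace ℝ (Fin n)) (TangentSpace (𝓡 n))
      x).open_baseSet.mem_nhds (FiberBundle.mem_baseSet_trivializationAt' x)] with y hy
    simp only [ContinuousLinearMap.inCoordinates, ContinuousLinearMap.comp_apply,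
      Bundle.Trivialization.continuousLinearMapAt_apply, Bundle.Trivialization.symmL_apply _ hy,
      Bundle.Trivialization.coe_linearMapAt_of_mem _ hy]
  · rw [Bundle.contMDiffAt_section]
    refine (contMDiffAt_const (c := v)).congr_of_eventuallyEq ?_
    filter_upwards [(trivializationAt (EuclideanSpace ℝ (Fin n)) (TangentSpace (𝓡 n))
      x).open_baseSet.mem_nhds (FiberBundle.mem_baseSet_trivializationAt' x)] with y hy
    exact (Bundle.Trivialization.apply_mk_symm _ hy v) ▸ rfl

end Calculus

end ParaQuat
end

noncomputable section

namespace ParaQuat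

/-! ### Local frames, their torsion, and connections written in a frame. -/

section Parallelization

variable {n : ℕ} {M : Type*} [TopologicalSpace M] [ChartedSpace (EuclideanSpace ℝ (Fin n)) M]
  [IsManifold (𝓡 n) ∞ M]
  {V : Type*} [NormedAddCommGroup V] [NormedSpace ℝ V]

/-- `X` is smooth at `x`. -/
abbrev SmoothFieldAt (X : VField n M) (x : M) : Prop :=
  ContMDiffAt (𝓡 n) (𝓡 n).tangent ∞ (fun x => (⟨x, X x⟩ : TangentBundle (𝓡 n) M)) x

/-- `X` is differentiable at `x`. -/
abbrev DiffFieldAt (X : VField n M) (x : M) : Prop :=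
  MDifferentiableAt (𝓡 n) (𝓡 n).tangent (fun x => (⟨x, X x⟩ : TangentBundle (𝓡 n) M)) x

theorem SmoothEndOn.smoothFieldAt_apply {A : EndField n M} {U : Set M} {x : M}
    (hA : SmoothEndOn A U) (hU : U ∈ nhds x) {X : VField n M} (hX : SmoothFieldAt X x) :
    SmoothFieldAt (fun y => A y (X y)) x :=
  ContMDiffAt.clm_bundle_apply (E₁ := fun y : M => TangentSpace (𝓡 n) y)
    (E₂ := fun y : M => TangentSpace (𝓡 n) y) (hA.contMDiffAt hU) hX

variable (n V) in
/-- A smooth trivialization of `TM` over an open set `U` with typical fibre `V`. -/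
structure Parallelization (U : Set M) where
  coord : ∀ x : M, TangentSpace (𝓡 n) x →L[ℝ] V
  frame : ∀ x : M, V →L[ℝ] TangentSpace (𝓡 n) x
  isOpen : IsOpen U
  frame_coord : ∀ x ∈ U, ∀ v, frame x (coord x v) = v
  coord_frame : ∀ x ∈ U, ∀ u, coord x (frame x u) = u
  contMDiffAt_frame : ∀ x ∈ U, ∀ u, SmoothFieldAt (fun y => frame y u) x
  mdifferentiableAt_coord : ∀ x ∈ U, ∀ X : VField n M, DiffFieldAt X x →
    MDifferentiableAt (𝓡 n) 𝓘(ℝ, V) (fun y => coord y (X y)) x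
  contMDiffAt_coord : ∀ x ∈ U, ∀ X : VField n M, SmoothFieldAt X x →
    ContMDiffAt (𝓡 n) 𝓘(ℝ, V) ∞ (fun y => coord y (X y)) x

namespace Parallelization

variable {U : Set M} (Φ : Parallelization n V U) {x : M}

include Φ in
theorem mem_nhds (hx : x ∈ U) : U ∈ nhds x := Φ.isOpen.mem_nhds hx

theorem mdifferentiableAt_frame (hx : x ∈ U) (u : V) : DiffFieldAt (fun y => Φ.frame y u) x :=
  (Φ.contMDiffAt_frame x hx u).mdifferentiableAt (by simp)

theorem contMDiffAt_frame_apply [FiniteDimensional ℝ V] (hx : x ∈ U) {s : M → V}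
    (hs : ContMDiffAt (𝓡 n) 𝓘(ℝ, V) ∞ s x) : SmoothFieldAt (fun y => Φ.frame y (s y)) x := by
  let b := Module.finBasis ℝ V
  have h : (fun y => Φ.frame y (s y)) = fun y => ∑ i,
      (LinearMap.toContinuousLinearMap (b.coord i) (s y)) • Φ.frame y (b i) := by
    funext y
    conv_lhs => rw [← b.sum_repr (s y), map_sum]
    simp
  rw [h]
  refine ContMDiffAt.sum_section fun i _ => ContMDiffAt.smul_section ?_ (Φ.contMDiffAt_frame x hx _)
  exact (ContinuousLinearMap.contMDiff _).contMDiffAt.comp x hs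

theorem mvfderiv_coord_frame (hx : x ∈ U) (u : V) :
    mvfderiv (𝓡 n) (fun y => Φ.coord y (Φ.frame y u)) x = 0 := by
  have h : (fun y => Φ.coord y (Φ.frame y u)) =ᶠ[nhds x] fun _ => u := by
    filter_upwards [Φ.mem_nhds hx] with y hy using Φ.coord_frame y hy u
  ext v
  change mfderiv (𝓡 n) 𝓘(ℝ, V) _ x v = 0
  rw [h.mfderiv_eq, mfderiv_const]
  rfl

/-- The negative of the torsion of the connection for which the frame is parallel, on vector fields
which need not be parallel. -/
def torsionAux (X Y : VField n M) (x : M) : V :=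
  mvfderiv (𝓡 n) (fun y => Φ.coord y (Y y)) x (X x)
    - mvfderiv (𝓡 n) (fun y => Φ.coord y (X y)) x (Y x)
    - Φ.coord x (VectorField.mlieBracket (𝓡 n) X Y x)

theorem torsionAux_swap (X Y : VField n M) (x : M) : Φ.torsionAux X Y x = -Φ.torsionAux Y X x := by
  simp only [torsionAux]
  rw [VectorField.mlieBracket_swap_apply, map_neg]
  abel

/-- The derivative of `f` produced by the bracket cancels the one produced by differentiating the
coordinates of `f X`. -/
theorem tensorialAt_torsionAux_left (hx : x ∈ U) (Y : VField n M) :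
    TensorialAt (𝓡 n) (EuclideanSpace ℝ (Fin n)) (fun X : VField n M => Φ.torsionAux X Y x) x where
  smul {f X} hf hX := by
    have h1 : (fun y => Φ.coord y ((f • X) y)) = f • fun y => Φ.coord y (X y) := by
      funext y; simp
    simp only [torsionAux]
    rw [h1, mvfderiv_smul hf (Φ.mdifferentiableAt_coord x hx X hX),
      VectorField.mlieBracket_smul_left hf hX]
    simp
    module
  add {X X'} hX hX' := by
    have h1 : (fun y => Φ.coord y ((X + X') y)) =
        (fun y => Φ.coord y (X y)) + fun y => Φ.coord y (X' y) := by
      funext y; simp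
    simp only [torsionAux]
    rw [h1, mvfderiv_add (Φ.mdifferentiableAt_coord x hx X hX)
      (Φ.mdifferentiableAt_coord x hx X' hX'), VectorField.mlieBracket_add_left hX hX']
    simp
    abel

theorem tensorialAt_torsionAux_right (hx : x ∈ U) (X : VField n M) :
    TensorialAt (𝓡 n) (EuclideanSpace ℝ (Fin n)) (fun Y : VField n M => Φ.torsionAux X Y x) x where
  smul hf hY := by
    simp only [Φ.torsionAux_swap X]
    rw [(Φ.tensorialAt_torsionAux_left hx X).smul hf hY, smul_neg]
  add hY hY' := by
    simp only [Φ.torsionAux_swap X]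
    rw [(Φ.tensorialAt_torsionAux_left hx X).add hY hY', neg_add]

variable [FiniteDimensional ℝ V]

open scoped Classical in
/-- The torsion of the connection for which the frame is parallel, read in the frame. -/
def torsion (x : M) : V →L[ℝ] V →L[ℝ] V :=
  if hx : x ∈ U then
    LinearMap.toContinuousBilinearMap (IsBilinearMap.toLinearMap (R := ℝ)
      (f := fun u w => -Φ.coord x (VectorField.mlieBracket (𝓡 n) (fun y => Φ.frame y u)
        (fun y => Φ.frame y w) x))
      { add_left u u' w := by
          have : (fun y => Φ.frame y (u + u')) = (fun y => Φ.frame y u) + fun y => Φ.frame y u' := by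
            funext y; simp
          rw [this, VectorField.mlieBracket_add_left (Φ.mdifferentiableAt_frame hx u)
            (Φ.mdifferentiableAt_frame hx u'), map_add, neg_add]
        smul_left c u w := by
          have : (fun y => Φ.frame y (c • u)) = c • (fun y => Φ.frame y u) := by
            funext y; simp
          rw [this, VectorField.mlieBracket_const_smul_left (Φ.mdifferentiableAt_frame hx u),
            map_smul, smul_neg]
        add_right u w w' := by
          have : (fun y => Φ.frame y (w + w')) = (fun y => Φ.frame y w) + fun y => Φ.frame y w' := by
            funext y; simp
          rw [this, VectorField.mlieBracket_add_right (Φ.mdifferentiableAt_frame hx w)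
            (Φ.mdifferentiableAt_frame hx w'), map_add, neg_add]
        smul_right c u w := by
          have : (fun y => Φ.frame y (c • w)) = c • (fun y => Φ.frame y w) := by
            funext y; simp
          rw [this, VectorField.mlieBracket_const_smul_right (Φ.mdifferentiableAt_frame hx w),
            map_smul, smul_neg] })
  -- Outside `U` the frame need not be differentiable, so bilinearity may fail; the value there
  -- plays no role.
  else 0

theorem torsion_apply (hx : x ∈ U) (u w : V) :
    Φ.torsion x u w = -Φ.coord x (VectorField.mlieBracket (𝓡 n) (fun y => Φ.frame y u)
        (fun y => Φ.frame y w) x) := by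
  rw [torsion, dif_pos hx]
  rfl

theorem torsion_swap (hx : x ∈ U) (u w : V) : Φ.torsion x u w = -Φ.torsion x w u := by
  rw [Φ.torsion_apply hx, Φ.torsion_apply hx, VectorField.mlieBracket_swap_apply, map_neg]

theorem contMDiffAt_torsion (hx : x ∈ U) :
    ContMDiffAt (𝓡 n) 𝓘(ℝ, V →L[ℝ] V →L[ℝ] V) ∞ Φ.torsion x := by
  refine contMDiffAt_clm_of_forall_apply fun u => contMDiffAt_clm_of_forall_apply fun w => ?_
  have h : (fun y => Φ.torsion y u w) =ᶠ[nhds x] fun y => -Φ.coord y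
      (VectorField.mlieBracket (𝓡 n) (fun y => Φ.frame y u) (fun y => Φ.frame y w) y) := by
    filter_upwards [Φ.mem_nhds hx] with y hy using Φ.torsion_apply hy u w
  refine ContMDiffAt.congr_of_eventuallyEq ?_ h
  refine ContMDiffAt.neg (Φ.contMDiffAt_coord x hx _ ?_)
  have : IsManifold (𝓡 n) (((⊤ : ℕ∞) : ℕ∞ω) + 1) M := by simpa
  have : IsManifold (𝓡 n) (minSmoothness ℝ 2) M := by
    rw [minSmoothness_of_isRCLikeNormedField]
    infer_instance
  exact ContMDiffAt.mlieBracket_vectorField (m := ⊤) (n := ⊤) (Φ.contMDiffAt_frame x hx u)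
    (Φ.contMDiffAt_frame x hx w) (by simp)

set_option synthInstance.maxHeartbeats 400000 in
theorem contMDiffAt_linearMap_torsion (hx : x ∈ U)
    (R : (V →L[ℝ] V →L[ℝ] V) →ₗ[ℝ] (V →L[ℝ] V →L[ℝ] V)) :
    ContMDiffAt (𝓡 n) 𝓘(ℝ, V →L[ℝ] V →L[ℝ] V) ∞ (fun y => R (Φ.torsion y)) x :=
  contMDiffAt_linearMap_comp (V := V →L[ℝ] V →L[ℝ] V) (W := V →L[ℝ] V →L[ℝ] V) R
    (Φ.contMDiffAt_torsion hx)

/-- Cartan's first structure equation. -/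
theorem coord_mlieBracket (hx : x ∈ U) {X Y : VField n M} (hX : DiffFieldAt X x)
    (hY : DiffFieldAt Y x) :
    Φ.coord x (VectorField.mlieBracket (𝓡 n) X Y x) =
      mvfderiv (𝓡 n) (fun y => Φ.coord y (Y y)) x (X x)
        - mvfderiv (𝓡 n) (fun y => Φ.coord y (X y)) x (Y x)
        - Φ.torsion x (Φ.coord x (X x)) (Φ.coord x (Y x)) := by
  -- By tensoriality `X` and `Y` may be replaced by the frame fields with the same values at `x`,
  -- whose coordinates have zero derivative.
  have h := TensorialAt.pointwise₂ (I := 𝓡 n) (F := EuclideanSpace ℝ (Fin n))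
    (F' := EuclideanSpace ℝ (Fin n)) (Φ := fun X Y : VField n M => Φ.torsionAux X Y x)
    (fun Y _ => Φ.tensorialAt_torsionAux_left hx Y)
    (fun X _ => Φ.tensorialAt_torsionAux_right hx X) hX
    (Φ.mdifferentiableAt_frame hx (Φ.coord x (X x))) hY
    (Φ.mdifferentiableAt_frame hx (Φ.coord x (Y x)))
    (Φ.frame_coord x hx _).symm (Φ.frame_coord x hx _).symm
  simp only [torsionAux] at h
  rw [Φ.mvfderiv_coord_frame hx, Φ.mvfderiv_coord_frame hx] at h
  rw [Φ.torsion_apply hx]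
  simp only [zero_apply, sub_zero, zero_sub] at h
  rw [← h]
  abel

/-- The connection which differs from the one for which the frame is parallel by the field `Γ` of
bilinear maps, read in the frame. -/
def connection (Γ : M → V →L[ℝ] V →L[ℝ] V) (X : VField n M) (x : M) :
    TangentSpace (𝓡 n) x →L[ℝ] TangentSpace (𝓡 n) x :=
  (Φ.frame x).comp (mvfderiv (𝓡 n) (fun y => Φ.coord y (X y)) x
    - ((Γ x).flip (Φ.coord x (X x))).comp (Φ.coord x))

omit [FiniteDimensional ℝ V] in
theorem connection_apply (Γ : M → V →L[ℝ] V →L[ℝ] V) (X : VField n M) (x : M)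
    (v : TangentSpace (𝓡 n) x) :
    Φ.connection Γ X x v = Φ.frame x (mvfderiv (𝓡 n) (fun y => Φ.coord y (X y)) x v
      - Γ x (Φ.coord x v) (Φ.coord x (X x))) := rfl

omit [FiniteDimensional ℝ V] in
theorem isCovariantDerivativeOn_connection (Γ : M → V →L[ℝ] V →L[ℝ] V) :
    IsCovariantDerivativeOn (I := 𝓡 n) (EuclideanSpace ℝ (Fin n)) (Φ.connection Γ) U where
  add {X X' x} hX hX' hx := by
    have h1 : (fun y => Φ.coord y ((X + X') y)) =
        (fun y => Φ.coord y (X y)) + fun y => Φ.coord y (X' y) := by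
      funext y; simp
    ext1 v
    simp only [connection_apply, add_apply]
    rw [h1, mvfderiv_add (Φ.mdifferentiableAt_coord x hx X hX)
      (Φ.mdifferentiableAt_coord x hx X' hX')]
    simp
    abel
  leibniz {X f x} hX hf hx := by
    have h1 : (fun y => Φ.coord y ((f • X) y)) = f • fun y => Φ.coord y (X y) := by
      funext y; simp
    ext1 v
    simp only [connection_apply, add_apply]
    rw [h1, mvfderiv_smul hf (Φ.mdifferentiableAt_coord x hx X hX)]
    simp [connection_apply, Φ.frame_coord x hx]
    module

theorem contMDiffCovariantDerivativeOn_connection {Γ : M → V →L[ℝ] V →L[ℝ] V}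
    (hΓ : ∀ x ∈ U, ContMDiffAt (𝓡 n) 𝓘(ℝ, V →L[ℝ] V →L[ℝ] V) ∞ Γ x) :
    ContMDiffCovariantDerivativeOn (I := 𝓡 n) (EuclideanSpace ℝ (Fin n)) ∞
      (Φ.connection Γ) U where
  contMDiff {X} hX x hx := by
    have hX' : SmoothFieldAt X x := (hX.contMDiffAt (Φ.mem_nhds hx)).of_le (by simp)
    refine ContMDiffAt.contMDiffWithinAt (contMDiffAt_hom_of_forall_apply fun Y hY => ?_)
    refine Φ.contMDiffAt_frame_apply hx ?_
    refine (contMDiffAt_mvfderiv_apply (Φ.contMDiffAt_coord x hx X hX') hY).sub ?_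
    exact ((hΓ x hx).clm_apply (Φ.contMDiffAt_coord x hx Y hY)).clm_apply
      (Φ.contMDiffAt_coord x hx X hX')

/-- Since `Γ` is subtracted from the frame connection, its skew-symmetrization is removed from the
torsion, and here the two are equal. -/
theorem connection_sub_swap {Γ : M → V →L[ℝ] V →L[ℝ] V} (hx : x ∈ U)
    (hΓ : ∀ u w, Γ x u w - Γ x w u = Φ.torsion x u w) {X Y : VField n M}
    (hX : DiffFieldAt X x) (hY : DiffFieldAt Y x) :
    Φ.connection Γ Y x (X x) - Φ.connection Γ X x (Y x) =
      VectorField.mlieBracket (𝓡 n) X Y x := by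
  rw [← Φ.frame_coord x hx (VectorField.mlieBracket (𝓡 n) X Y x), Φ.coord_mlieBracket hx hX hY,
    connection_apply, connection_apply, ← map_sub, ← hΓ]
  congr 1
  abel

/-- A field of endomorphisms read in the frame. -/
def endCoord (A : EndField n M) (x : M) : V →L[ℝ] V :=
  (Φ.coord x).comp ((A x).comp (Φ.frame x))

omit [FiniteDimensional ℝ V] in
theorem coord_apply (A : EndField n M) (hx : x ∈ U) (v : TangentSpace (𝓡 n) x) :
    Φ.coord x (A x v) = Φ.endCoord A x (Φ.coord x v) := by
  simp [endCoord, Φ.frame_coord x hx]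

theorem contMDiffAt_endCoord {A : EndField n M} (hA : SmoothEndOn A Set.univ) (hx : x ∈ U) :
    ContMDiffAt (𝓡 n) 𝓘(ℝ, V →L[ℝ] V) ∞ (Φ.endCoord A) x := by
  refine contMDiffAt_clm_of_forall_apply fun u => ?_
  exact Φ.contMDiffAt_coord x hx (fun y => A y (Φ.frame y u))
    (hA.smoothFieldAt_apply Filter.univ_mem (Φ.contMDiffAt_frame x hx u))

theorem mvfderiv_coord_endField {A : EndField n M} (hA : SmoothEndOn A Set.univ) (hx : x ∈ U)
    {X : VField n M} (hX : DiffFieldAt X x) (v : TangentSpace (𝓡 n) x) :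
    mvfderiv (𝓡 n) (fun y => Φ.coord y (A y (X y))) x v =
      mvfderiv (𝓡 n) (Φ.endCoord A) x v (Φ.coord x (X x))
        + Φ.endCoord A x (mvfderiv (𝓡 n) (fun y => Φ.coord y (X y)) x v) := by
  rw [← mvfderiv_clm_apply ((Φ.contMDiffAt_endCoord hA hx).mdifferentiableAt (by simp))
    (Φ.mdifferentiableAt_coord x hx X hX)]
  have h : (fun y => Φ.coord y (A y (X y))) =ᶠ[nhds x]
      fun y => Φ.endCoord A y (Φ.coord y (X y)) := by
    filter_upwards [Φ.mem_nhds hx] with y hy using Φ.coord_apply A hy _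
  change mfderiv (𝓡 n) 𝓘(ℝ, V) (fun y => Φ.coord y (A y (X y))) x v =
    mfderiv (𝓡 n) 𝓘(ℝ, V) (fun y => Φ.endCoord A y (Φ.coord y (X y))) x v
  rw [h.mfderiv_eq]
  rfl

/-- The connection acts on endomorphisms by the derivative in the frame and a commutator. -/
theorem connection_endField {A : EndField n M} (hA : SmoothEndOn A Set.univ) (hx : x ∈ U)
    (Γ : M → V →L[ℝ] V →L[ℝ] V) {X : VField n M} (hX : DiffFieldAt X x)
    (v : TangentSpace (𝓡 n) x) :
    Φ.connection Γ (fun y => A y (X y)) x v - A x (Φ.connection Γ X x v) =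
      Φ.frame x ((mvfderiv (𝓡 n) (Φ.endCoord A) x v
        - (Γ x (Φ.coord x v) * Φ.endCoord A x - Φ.endCoord A x * Γ x (Φ.coord x v)))
          (Φ.coord x (X x))) := by
  rw [← Φ.frame_coord x hx (A x (Φ.connection Γ X x v)), Φ.coord_apply A hx, connection_apply,
    connection_apply, Φ.coord_frame x hx, ← map_sub, Φ.mvfderiv_coord_endField hA hx hX,
    Φ.coord_apply A hx]
  congr 1
  simp
  abel

end Parallelization

end Parallelization

end ParaQuat
end

noncomputable section

namespace ParaQuat

/-! ### From a smooth family of linear maps to a local trivialization. -/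

section Frames

variable {n : ℕ} {M : Type*} [TopologicalSpace M] [ChartedSpace (EuclideanSpace ℝ (Fin n)) M]
  [IsManifold (𝓡 n) ∞ M]
  {V : Type*} [NormedAddCommGroup V] [NormedSpace ℝ V] [FiniteDimensional ℝ V]

/-- Read in a trivialization, the family is a smooth map into operators; invertible operators form
an open set on which inversion is smooth, so bijectivity at `p` persists nearby. -/
theorem exists_parallelization {U₀ : Set M} (hU₀ : IsOpen U₀) {p : M} (hp : p ∈ U₀)
    (frame : ∀ x : M, V →L[ℝ] TangentSpace (𝓡 n) x)
    (hframe : ∀ x ∈ U₀, ∀ u, SmoothFieldAt (fun y => frame y u) x)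
    (hb : Function.Bijective (frame p)) :
    ∃ U ⊆ U₀, p ∈ U ∧ ∃ Φ : Parallelization n V U, Φ.frame = frame := by
  let e := trivializationAt (EuclideanSpace ℝ (Fin n)) (TangentSpace (𝓡 n) : M → Type _) p
  have hpe : p ∈ e.baseSet := FiberBundle.mem_baseSet_trivializationAt' p
  let G : M → V →L[ℝ] EuclideanSpace ℝ (Fin n) := fun y =>
    (e.continuousLinearMapAt ℝ y).comp (frame y)
  have he : ∀ y ∈ e.baseSet, ∀ v : TangentSpace (𝓡 n) y,
      e.continuousLinearMapAt ℝ y v = (e ⟨y, v⟩).2 := fun y hy v => by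
    rw [Bundle.Trivialization.continuousLinearMapAt_apply,
      Bundle.Trivialization.coe_linearMapAt_of_mem _ hy]
  have hes : ∀ y ∈ e.baseSet, ∀ v : TangentSpace (𝓡 n) y,
      e.symmL ℝ y (e.continuousLinearMapAt ℝ y v) = v := fun y hy v =>
    e.symmL_continuousLinearMapAt hy v
  have hev : ∀ x ∈ e.baseSet, ∀ X : VField n M, (fun y => (e ⟨y, X y⟩).2) =ᶠ[nhds x]
      fun y => e.continuousLinearMapAt ℝ y (X y) := fun x hx X => by
    filter_upwards [e.open_baseSet.mem_nhds hx] with y hy using (he y hy _).symm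
  have hsec : ∀ x ∈ e.baseSet, ∀ X : VField n M, SmoothFieldAt X x →
      ContMDiffAt (𝓡 n) 𝓘(ℝ, EuclideanSpace ℝ (Fin n)) ∞
        (fun y => e.continuousLinearMapAt ℝ y (X y)) x := fun x hx X hX =>
    ((e.contMDiffAt_section_iff hx).1 hX).congr_of_eventuallyEq (hev x hx X).symm
  have hdsec : ∀ x ∈ e.baseSet, ∀ X : VField n M, DiffFieldAt X x →
      MDifferentiableAt (𝓡 n) 𝓘(ℝ, EuclideanSpace ℝ (Fin n))
        (fun y => e.continuousLinearMapAt ℝ y (X y)) x := fun x hx X hX =>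
    ((e.mdifferentiableAt_section_iff (𝓡 n) X hx).1 hX).congr_of_eventuallyEq (hev x hx X).symm
  have hG : ∀ x ∈ U₀ ∩ e.baseSet,
      ContMDiffAt (𝓡 n) 𝓘(ℝ, V →L[ℝ] EuclideanSpace ℝ (Fin n)) ∞ G x := fun x hx =>
    contMDiffAt_clm_of_forall_apply fun u => hsec x hx.2 _ (hframe x hx.1 u)
  have hGp : (G p).IsInvertible := by
    have hbij : Function.Bijective (G p) := by
      have h := (e.continuousLinearEquivAt ℝ p hpe).bijective
      rw [e.coe_continuousLinearEquivAt_eq hpe] at h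
      exact h.comp hb
    exact ⟨(LinearEquiv.ofBijective (G p).toLinearMap hbij).toContinuousLinearEquiv, by
      ext; rfl⟩
  let U := (U₀ ∩ e.baseSet) ∩ G ⁻¹' Set.range
    ((↑) : (V ≃L[ℝ] EuclideanSpace ℝ (Fin n)) → V →L[ℝ] EuclideanSpace ℝ (Fin n))
  have hU : IsOpen U := ContinuousOn.isOpen_inter_preimage
    (fun x hx => (hG x hx).continuousAt.continuousWithinAt) (hU₀.inter e.open_baseSet)
    ContinuousLinearEquiv.isOpen
  have hinv : ∀ x ∈ U, ContMDiffAt (𝓡 n) 𝓘(ℝ, EuclideanSpace ℝ (Fin n) →L[ℝ] V) ∞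
      (fun y => (G y).inverse) x := fun x hx =>
    (ContinuousLinearMap.IsInvertible.contDiffAt_map_inverse hx.2).contMDiffAt.comp x (hG x hx.1)
  refine ⟨U, fun x hx => hx.1.1, ⟨⟨hp, hpe⟩, hGp⟩, ⟨⟨fun y => (G y).inverse.comp
    (e.continuousLinearMapAt ℝ y), frame, hU, ?_, ?_, fun x hx => hframe x hx.1.1, ?_, ?_⟩, rfl⟩⟩
  · intro x hx v
    rw [← hes x hx.1.2 (frame x _), ← hes x hx.1.2 v]
    congr 1
    obtain ⟨L, hL⟩ := hx.2
    change G x ((G x).inverse (e.continuousLinearMapAt ℝ x _)) = _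
    rw [← hL, ContinuousLinearMap.inverse_equiv, hes x hx.1.2]
    simp
  · intro x hx u
    obtain ⟨L, hL⟩ := hx.2
    change (G x).inverse (G x u) = u
    rw [← hL, ContinuousLinearMap.inverse_equiv]
    simp
  · intro x hx X hX
    exact ((hinv x hx).mdifferentiableAt (by simp)).clm_apply (hdsec x hx.1.2 X hX)
  · intro x hx X hX
    exact (hinv x hx).clm_apply (hsec x hx.1.2 X hX)

end Frames

end ParaQuat
end

noncomputable section

namespace ParaQuat

/-! ### Frames in which `P` has constant matrices. -/

section AdaptedFrame

section Linear

variable {k : ℕ} {T : Type*} [AddCommGroup T] [Module ℝ T] [TopologicalSpace T]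
  [IsTopologicalAddGroup T] [ContinuousSMul ℝ T]

/-- The linear map `(u, w) ↦ ∑ uₐ fₐ + ∑ wₐ J fₐ`. -/
def adaptedFrame (J : T →L[ℝ] T) (f : Fin k → T) : (Fin k → ℝ) × (Fin k → ℝ) →L[ℝ] T :=
  ∑ a, ((ContinuousLinearMap.proj (R := ℝ) (φ := fun _ : Fin k => ℝ) a).comp
      (ContinuousLinearMap.fst ℝ _ _)).smulRight (f a)
    + ∑ a, ((ContinuousLinearMap.proj (R := ℝ) (φ := fun _ : Fin k => ℝ) a).comp
      (ContinuousLinearMap.snd ℝ _ _)).smulRight (J (f a))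

theorem adaptedFrame_apply (J : T →L[ℝ] T) (f : Fin k → T) (u w : Fin k → ℝ) :
    adaptedFrame J f (u, w) = ∑ a, u a • f a + J (∑ a, w a • f a) := by
  simp [adaptedFrame]

/-- The combination of a triple of endomorphisms with given coefficients. -/
def tripleMap (J₁ J₂ J₃ : T →L[ℝ] T) : (Fin 3 → ℝ) →ₗ[ℝ] (T →L[ℝ] T) where
  toFun c := c 0 • J₁ + c 1 • J₂ + c 2 • J₃
  map_add' c d := by
    simp only [Pi.add_apply, add_smul]
    abel
  map_smul' r c := by
    simp only [Pi.smul_apply, smul_eq_mul, mul_smul, smul_add, RingHom.id_apply]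

theorem tripleMap_apply (J₁ J₂ J₃ : T →L[ℝ] T) (c : Fin 3 → ℝ) :
    tripleMap J₁ J₂ J₃ c = c 0 • J₁ + c 1 • J₂ + c 2 • J₃ := rfl

theorem range_tripleMap (J₁ J₂ J₃ : T →L[ℝ] T) :
    LinearMap.range (tripleMap J₁ J₂ J₃) = Submodule.span ℝ {J₁, J₂, J₃} := by
  ext A
  rw [Submodule.mem_span_triple]
  constructor
  · rintro ⟨c, rfl⟩
    exact ⟨c 0, c 1, c 2, rfl⟩
  · rintro ⟨a, b, c, rfl⟩
    exact ⟨![a, b, c], rfl⟩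

variable {J₁ J₂ J₃ : T →L[ℝ] T}

omit [ContinuousSMul ℝ T] in
theorem IsAdmissibleTriple.apply_identities (h : IsAdmissibleTriple J₁ J₂ J₃) (v : T) :
    J₁ (J₁ v) = -v ∧ J₂ (J₂ v) = v ∧ J₂ (J₁ v) = -J₁ (J₂ v) ∧ J₃ v = J₁ (J₂ v) := by
  have s1 : ∀ v, J₁ (J₁ v) = -v := fun v => DFunLike.congr_fun h.isComplex v
  have s2 : ∀ v, J₂ (J₂ v) = v := fun v => DFunLike.congr_fun h.isParaComplex₂.1 v
  have e3 : ∀ v, J₃ v = J₁ (J₂ v) := fun v => DFunLike.congr_fun h.eq_mul v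
  have ac : ∀ v, J₂ (J₃ v) = -J₃ (J₂ v) := fun v => DFunLike.congr_fun h.anticomm v
  refine ⟨s1 v, s2 v, ?_, e3 v⟩
  have := ac (J₂ v)
  rwa [e3, e3, s2] at this

theorem IsAdmissibleTriple.apply_adaptedFrame (h : IsAdmissibleTriple J₁ J₂ J₃) {f : Fin k → T}
    (hf : ∀ a, J₂ (f a) = f a) (c : Fin 3 → ℝ) (u : (Fin k → ℝ) × (Fin k → ℝ)) :
    tripleMap J₁ J₂ J₃ c (adaptedFrame J₁ f u) =
      adaptedFrame J₁ f (modelEnd (Fin k → ℝ) c u) := by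
  obtain ⟨u, w⟩ := u
  have hf' : ∀ u : Fin k → ℝ, J₂ (∑ a, u a • f a) = ∑ a, u a • f a := fun u => by simp [hf]
  have hadd : ∀ (s t : ℝ) (u w : Fin k → ℝ), ∑ a, (s • u + t • w) a • f a =
      s • ∑ a, u a • f a + t • ∑ a, w a • f a := fun s t u w => by
    simp [add_smul, mul_smul, Finset.sum_add_distrib, Finset.smul_sum]
  rw [tripleMap_apply, modelEnd_apply, sub_eq_add_neg _ (c 1 • w), ← neg_smul, adaptedFrame_apply, adaptedFrame_apply, hadd,
    hadd]
  simp only [add_apply, FunLike.coe_smul, Pi.smul_apply, map_add, map_smul,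
    (h.apply_identities _).1, (h.apply_identities _).2.2.1, (h.apply_identities _).2.2.2, hf',
    map_neg]
  module

/-- `J₁` anticommutes with `J₂`, so it exchanges the eigenspaces of `J₂`, and the whole space is `K
⊕ J₁ K`. -/
theorem IsAdmissibleTriple.adaptedFrame_bijective (h : IsAdmissibleTriple J₁ J₂ J₃)
    {K : Submodule ℝ T} (hK : ∀ v, v ∈ K ↔ J₂ v = v) (b : Module.Basis (Fin k) ℝ K) :
    Function.Bijective (adaptedFrame J₁ (fun a => (b a : T))) := by
  have hf : ∀ a, J₂ (b a : T) = b a := fun a => (hK _).1 (b a).2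
  have hf' : ∀ u : Fin k → ℝ, J₂ (∑ a, u a • (b a : T)) = ∑ a, u a • (b a : T) := fun u => by
    simp [hf]
  have hinj : ∀ u : Fin k → ℝ, ∑ a, u a • (b a : T) = 0 → u = 0 := fun u hu => by
    funext a
    refine Fintype.linearIndependent_iff.1 b.linearIndependent u (Subtype.ext ?_) a
    simpa using hu
  have hspan : ∀ v, J₂ v = v → ∃ u : Fin k → ℝ, ∑ a, u a • (b a : T) = v := fun v hv => by
    refine ⟨b.repr ⟨v, (hK v).2 hv⟩, ?_⟩
    have := congrArg K.subtype (b.sum_repr ⟨v, (hK v).2 hv⟩)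
    simpa only [map_sum, map_smul, Submodule.subtype_apply] using this
  constructor
  · rw [injective_iff_map_eq_zero]
    rintro ⟨u, w⟩ huw
    rw [adaptedFrame_apply] at huw
    have h1 := congrArg J₂ huw
    rw [map_add, (h.apply_identities _).2.2.1, hf', hf', map_zero] at h1
    have h2 : ∑ a, u a • (b a : T) = 0 := by
      linear_combination (norm := module) (1 / 2 : ℝ) • huw + (1 / 2 : ℝ) • h1
    have h3 : ∑ a, w a • (b a : T) = 0 := by
      have h4 := (h.apply_identities (∑ a, w a • (b a : T))).1
      rw [h2, zero_add] at huw
      rw [huw, map_zero] at h4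
      exact neg_eq_zero.1 h4.symm
    rw [hinj u h2, hinj w h3]
    rfl
  · intro v
    obtain ⟨u, hu⟩ := hspan ((1 / 2 : ℝ) • (v + J₂ v)) (by
      rw [map_smul, map_add, (h.apply_identities _).2.1, add_comm])
    -- The component of `v` with eigenvalue `-1` is `J₁` of this vector, because `J₁² = -1`.
    obtain ⟨w, hw⟩ := hspan (-J₁ ((1 / 2 : ℝ) • (v - J₂ v))) (by
      rw [map_neg, (h.apply_identities _).2.2.1, map_smul, map_sub, (h.apply_identities _).2.1,
        ← map_neg, ← smul_neg, neg_sub])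
    refine ⟨(u, w), ?_⟩
    rw [adaptedFrame_apply, hu, hw, map_neg, (h.apply_identities _).1]
    module

end Linear

variable {n : ℕ} {M : Type*} [TopologicalSpace M] [ChartedSpace (EuclideanSpace ℝ (Fin n)) M]
  [IsManifold (𝓡 n) ∞ M]

/-- Integrability is tested on global smooth fields, so tangent vectors must extend globally: a
local extension is cut off by a bump function. -/
theorem exists_smoothVField [T2Space M] {p : M} (v : TangentSpace (𝓡 n) p) :
    ∃ X : VField n M, SmoothVField X ∧ X p = v := by
  obtain ⟨s, hs, hX⟩ := FiberBundle.exists_contMDiffOn_extend (𝓡 n) (EuclideanSpace ℝ (Fin n))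
    (V := (TangentSpace (𝓡 n) : M → Type _)) (k := ∞) v
  obtain ⟨ψ, -, hψ⟩ := (SmoothBumpFunction.nhds_basis_tsupport (I := 𝓡 n) p).mem_iff.1
    (interior_mem_nhds.2 hs)
  refine ⟨fun x => ψ x • FiberBundle.extend (EuclideanSpace ℝ (Fin n)) v x, ?_, ?_⟩
  · exact ContMDiffOn.smul_section_of_tsupport ψ.contMDiff.contMDiffOn isOpen_interior hψ
      (hX.mono interior_subset)
  · simp

/-- The endomorphisms in `P` are those which have constant model matrices in the frame. -/
def Parallelization.IsAdapted {E : Type*} [NormedAddCommGroup E] [NormedSpace ℝ E] {U : Set M}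
    (Φ : Parallelization n (E × E) U) (P : AlmostParaQuaternionic n M) : Prop :=
  ∀ x ∈ U, ∃ J₁ J₂ J₃ : TangentSpace (𝓡 n) x →L[ℝ] TangentSpace (𝓡 n) x,
    IsAdmissibleTriple J₁ J₂ J₃ ∧ P.fiber x = LinearMap.range (tripleMap J₁ J₂ J₃) ∧
      ∀ c u, tripleMap J₁ J₂ J₃ c (Φ.frame x u) = Φ.frame x (modelEnd E c u)

variable [T2Space M]

theorem AlmostParaQuaternionic.exists_adapted_parallelization (P : AlmostParaQuaternionic n M)
    (p : M) : ∃ (U : Set M) (_ : p ∈ U) (k : ℕ)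
      (Φ : Parallelization n ((Fin k → ℝ) × (Fin k → ℝ)) U), Φ.IsAdapted P := by
  obtain ⟨U₀, hU₀, hp, J₁, J₂, J₃, hJ₁, hJ₂, -, hJ⟩ := P.exists_frame p
  have : FiniteDimensional ℝ (TangentSpace (𝓡 n) p) :=
    inferInstanceAs (FiniteDimensional ℝ (EuclideanSpace ℝ (Fin n)))
  let K : Submodule ℝ (TangentSpace (𝓡 n) p) := LinearMap.ker
    ((J₂ p - 1 : TangentSpace (𝓡 n) p →L[ℝ] TangentSpace (𝓡 n) p) :
      TangentSpace (𝓡 n) p →ₗ[ℝ] TangentSpace (𝓡 n) p)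
  have hK : ∀ v, v ∈ K ↔ J₂ p v = v := fun v => sub_eq_zero
  obtain ⟨k, ⟨b⟩⟩ : ∃ k, Nonempty (Module.Basis (Fin k) ℝ K) := ⟨_, ⟨Module.finBasis ℝ K⟩⟩
  choose F hF hFp using fun a => exists_smoothVField (b a : TangentSpace (𝓡 n) p)
  -- The projection `(1 + J₂) / 2` makes the fields sections of the `+1` eigenbundle of `J₂` on `U₀`
  -- without changing their values at `p`.
  let f : ∀ x : M, Fin k → TangentSpace (𝓡 n) x := fun x a => (1 / 2 : ℝ) • (F a x + J₂ x (F a x))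
  have hfs : ∀ x ∈ U₀, ∀ a, SmoothFieldAt (fun y => f y a) x := fun x hx a =>
    ContMDiffAt.const_smul_section (((hF a).contMDiffAt).add_section
      (hJ₂.smoothFieldAt_apply (hU₀.mem_nhds hx) (hF a).contMDiffAt))
  have hf : ∀ x ∈ U₀, ∀ a, J₂ x (f x a) = f x a := fun x hx a => by
    simp only [f]
    rw [map_smul, map_add, ((hJ x hx).1.apply_identities _).2.1, add_comm]
  have hfp : f p = fun a => (b a : TangentSpace (𝓡 n) p) := by
    funext a
    simp only [f]
    rw [hFp, (hK _).1 (b a).2]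
    module
  obtain ⟨U, hU, hpU, Φ, hΦ⟩ := exists_parallelization hU₀ hp
    (fun x => adaptedFrame (J₁ x) (f x)) (fun x hx u => by
      have h1 : (fun y => adaptedFrame (J₁ y) (f y) u) =
          fun y => ∑ a, u.1 a • f y a + ∑ a, u.2 a • J₁ y (f y a) := by
        funext y
        rw [← Prod.mk.eta (p := u), adaptedFrame_apply]
        simp
      rw [h1]
      refine ContMDiffAt.add_section (ContMDiffAt.sum_section fun a _ =>
        ContMDiffAt.const_smul_section (hfs x hx a)) (ContMDiffAt.sum_section fun a _ =>
        ContMDiffAt.const_smul_section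
          (hJ₁.smoothFieldAt_apply (hU₀.mem_nhds hx) (hfs x hx a))))
    (by simp only [hfp]; exact (hJ p hp).1.adaptedFrame_bijective hK b)
  refine ⟨U, hpU, _, Φ, fun x hx => ⟨J₁ x, J₂ x, J₃ x, (hJ x (hU hx)).1,
    (hJ x (hU hx)).2.trans (range_tripleMap _ _ _).symm, ?_⟩⟩
  rw [hΦ]
  exact (hJ x (hU hx)).1.apply_adaptedFrame (hf x (hU hx))

end AdaptedFrame

end ParaQuat
end

noncomputable section

namespace ParaQuat

/-! ### Endomorphisms, coefficient triples and Gram determinants at a point. -/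

section PointwiseCases

variable {T : Type*} [AddCommGroup T] [Module ℝ T] [TopologicalSpace T]
  [IsTopologicalAddGroup T] [ContinuousSMul ℝ T] {J₁ J₂ J₃ : T →L[ℝ] T}

namespace IsAdmissibleTriple

theorem stdMetric_tripleMap (h : IsAdmissibleTriple J₁ J₂ J₃) (hT : Module.finrank ℝ T ≠ 0)
    (c d : Fin 3 → ℝ) :
    stdMetric (tripleMap J₁ J₂ J₃ c) (tripleMap J₁ J₂ J₃ d) = lorentz c d :=
  (stdMetric_sum hT h _ _ _ _ _ _).trans (by rw [lorentz])

theorem tripleMap_injective (h : IsAdmissibleTriple J₁ J₂ J₃) (hT : Module.finrank ℝ T ≠ 0) :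
    Function.Injective (tripleMap J₁ J₂ J₃) := by
  rw [injective_iff_map_eq_zero]
  intro c hc
  have key : ∀ d, lorentz c d = 0 := fun d => by
    rw [← h.stdMetric_tripleMap hT, hc, map_zero, LinearMap.zero_apply]
  have h0 := key ![1, 0, 0]
  have h1 := key ![0, 1, 0]
  have h2 := key ![0, 0, 1]
  simp [lorentz] at h0 h1 h2
  funext i
  fin_cases i <;> assumption

theorem lorentz_of_sq (h : IsAdmissibleTriple J₁ J₂ J₃) (hT : Module.finrank ℝ T ≠ 0) {ε : ℝ}
    {c : Fin 3 → ℝ} (hc : tripleMap J₁ J₂ J₃ c * tripleMap J₁ J₂ J₃ c = ε • (1 : T →L[ℝ] T)) :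
    lorentz c c = ε := by
  rw [← h.stdMetric_tripleMap hT, stdMetric_self hT hc]

end IsAdmissibleTriple

omit [ContinuousSMul ℝ T] in
theorem isNondegenerateSpan_iff [ContinuousConstSMul ℝ T] {A B : T →L[ℝ] T} :
    IsNondegenerateSpan A B ↔ ∀ a b : ℝ, a * stdMetric A A + b * stdMetric B A = 0 →
      a * stdMetric A B + b * stdMetric B B = 0 → a • A + b • B = 0 := by
  have hsymm : ((stdMetric (V := T)).restrict (Submodule.span ℝ {A, B})).IsRefl := fun x y hxy => by
    rw [LinearMap.BilinForm.restrict_apply, LinearMap.domRestrict_apply, stdMetric_comm]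
    exact hxy
  rw [IsNondegenerateSpan, LinearMap.BilinForm.Nondegenerate,
    LinearMap.IsRefl.nondegenerate_iff_separatingLeft hsymm]
  constructor
  · intro h a b hA hB
    refine congrArg Subtype.val (h ⟨a • A + b • B, Submodule.mem_span_pair.2 ⟨a, b, rfl⟩⟩ ?_)
    rintro ⟨C, hC⟩
    obtain ⟨c, d, rfl⟩ := Submodule.mem_span_pair.1 hC
    change stdMetric (a • A + b • B) (c • A + d • B) = 0
    simp only [map_add, map_smul, LinearMap.add_apply, LinearMap.smul_apply, smul_eq_mul]
    linear_combination c * hA + d * hB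
  · rintro h ⟨C, hC⟩ hCC
    obtain ⟨a, b, rfl⟩ := Submodule.mem_span_pair.1 hC
    have h1 := hCC ⟨A, Submodule.subset_span (by simp)⟩
    have h2 := hCC ⟨B, Submodule.subset_span (by simp)⟩
    change stdMetric (a • A + b • B) _ = 0 at h1 h2
    simp only [map_add, map_smul, LinearMap.add_apply, LinearMap.smul_apply, smul_eq_mul] at h1 h2
    exact Subtype.ext (h a b h1 h2)

omit [ContinuousSMul ℝ T] in
theorem gram_ne_zero_of_isNondegenerateSpan [ContinuousConstSMul ℝ T] {A B : T →L[ℝ] T}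
    (hAB : LinearIndependent ℝ ![A, B])
    (h : IsNondegenerateSpan A B) (hB : stdMetric B B ≠ 0) :
    stdMetric A A * stdMetric B B - stdMetric A B ^ 2 ≠ 0 := fun h0 => by
  -- If the Gram determinant vanished, `⟨B, B⟩ A - ⟨A, B⟩ B` would be orthogonal to both `A` and
  -- `B`.
  have h1 := isNondegenerateSpan_iff.1 h (stdMetric B B) (-stdMetric A B)
    (by rw [stdMetric_comm B A]; linear_combination h0) (by ring)
  exact hB (LinearIndependent.pair_iff.1 hAB _ _ h1).1

omit [ContinuousSMul ℝ T] in
theorem gram_eq_zero_of_not_isNondegenerateSpan [ContinuousConstSMul ℝ T] {A B : T →L[ℝ] T}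
    (h : ¬IsNondegenerateSpan A B) :
    stdMetric A A * stdMetric B B - stdMetric A B ^ 2 = 0 := by
  by_contra h0
  refine h (isNondegenerateSpan_iff.2 fun a b h1 h2 => ?_)
  rw [stdMetric_comm B A] at h1
  have ha : a = 0 := by
    refine (mul_eq_zero.1 ?_).resolve_right h0
    linear_combination stdMetric B B * h1 - stdMetric A B * h2
  have hb : b = 0 := by
    refine (mul_eq_zero.1 ?_).resolve_right h0
    linear_combination stdMetric A A * h2 - stdMetric A B * h1
  rw [ha, hb, zero_smul, zero_smul, add_zero]

theorem linearIndependent_pair_of_tripleMap {c d : Fin 3 → ℝ}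
    (hcd : LinearIndependent ℝ ![tripleMap J₁ J₂ J₃ c, tripleMap J₁ J₂ J₃ d]) :
    LinearIndependent ℝ ![c, d] := by
  refine LinearIndependent.of_comp (tripleMap J₁ J₂ J₃) ?_
  convert hcd using 1
  funext i
  fin_cases i <;> rfl

end PointwiseCases

/-! ### Linear choice of preimages. -/

theorem _root_.LinearMap.exists_section_on_range {V W : Type*} [AddCommGroup V] [Module ℝ V]
    [AddCommGroup W] [Module ℝ W] (f : V →ₗ[ℝ] W) :
    ∃ s : W →ₗ[ℝ] V, ∀ w ∈ LinearMap.range f, f (s w) = w := by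
  obtain ⟨r, hr⟩ := f.rangeRestrict.exists_rightInverse_of_surjective (LinearMap.range_rangeRestrict _)
  obtain ⟨s, hs⟩ := LinearMap.exists_extend r
  refine ⟨s, fun w hw => ?_⟩
  rw [show s w = r ⟨w, hw⟩ from LinearMap.congr_fun hs ⟨w, hw⟩]
  exact congrArg Subtype.val (LinearMap.congr_fun hr ⟨w, hw⟩)

/-- One linear `R` serves all solvable right-hand sides, so that a smooth field of torsions yields a
smooth field of solutions; separate choices at each point would not. -/
theorem _root_.LinearMap.exists_section_within {W : Type*} [AddCommGroup W] [Module ℝ W]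
    (f : W →ₗ[ℝ] W) (N : Submodule ℝ W) :
    ∃ R : W →ₗ[ℝ] W, ∀ T, (∃ B ∈ N, f B = T) → R T ∈ N ∧ f (R T) = T := by
  obtain ⟨s, hs⟩ := (f.comp N.subtype).exists_section_on_range
  refine ⟨N.subtype.comp s, ?_⟩
  rintro T ⟨B, hB, hBT⟩
  exact ⟨(s T).2, hs T ⟨⟨B, hB⟩, hBT⟩⟩

/-- A linear right inverse of skew-symmetrization on a space of bilinear maps. -/
theorem exists_skewSymmetrization_rightInverse {V : Type*} [NormedAddCommGroup V]
    [NormedSpace ℝ V] (N : Submodule ℝ (V →L[ℝ] V →L[ℝ] V)) :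
    ∃ R : (V →L[ℝ] V →L[ℝ] V) →ₗ[ℝ] (V →L[ℝ] V →L[ℝ] V),
      ∀ T, (∃ B ∈ N, ∀ X Y, B X Y - B Y X = T X Y) →
        R T ∈ N ∧ ∀ X Y, R T X Y - R T Y X = T X Y := by
  obtain ⟨R, hR⟩ := LinearMap.exists_section_within (LinearMap.id -
    (ContinuousLinearMap.flipₗᵢ ℝ V V V).toLinearEquiv.toLinearMap) N
  refine ⟨R, ?_⟩
  rintro T ⟨B, hB, hBT⟩
  obtain ⟨h1, h2⟩ := hR T ⟨B, hB, ContinuousLinearMap.ext fun X => ContinuousLinearMap.ext fun Y =>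
    hBT X Y⟩
  exact ⟨h1, fun X Y => DFunLike.congr_fun (DFunLike.congr_fun h2 X) Y⟩

/-! ### The Nijenhuis tensor in an adapted frame, and the local connection. -/

section NijenhuisEquation

variable {n : ℕ} {M : Type*} [TopologicalSpace M] [ChartedSpace (EuclideanSpace ℝ (Fin n)) M]
  [IsManifold (𝓡 n) ∞ M]

/-- `I` is smooth, satisfies `I² = ε Id`, and has vanishing Nijenhuis tensor. -/
structure IsIntegrable (ε : ℝ) (I : EndField n M) : Prop where
  smooth : SmoothEndOn I Set.univ
  sq : ∀ x, I x * I x = ε • (1 : TangentSpace (𝓡 n) x →L[ℝ] TangentSpace (𝓡 n) x)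
  integrable : ∀ X Y : VField n M, SmoothVField X → SmoothVField Y →
    ∀ x, nijenhuis ε I X Y x = 0

theorem IsComplexStructure.isIntegrable {I : EndField n M} (h : IsComplexStructure I) :
    IsIntegrable (-1) I :=
  ⟨h.smooth, fun x => (h.isComplex x).trans (by rw [neg_smul, one_smul]), h.integrable⟩

theorem IsParaComplexStructure.isIntegrable {I : EndField n M} (h : IsParaComplexStructure I) :
    IsIntegrable 1 I :=
  ⟨h.smooth, fun x => (h.isParaComplex x).1.trans (by rw [one_smul]), h.integrable⟩

variable {E : Type*} [NormedAddCommGroup E] [NormedSpace ℝ E] {U : Set M}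
  {Φ : Parallelization n (E × E) U} {P : AlmostParaQuaternionic n M} {x : M}

namespace Parallelization.IsAdapted

theorem endCoord_mem (hΦ : Φ.IsAdapted P) {A : EndField n M} (hA : P.Compatible A) (hx : x ∈ U) :
    Φ.endCoord A x ∈ LinearMap.range (modelEnd E) := by
  obtain ⟨J₁, J₂, J₃, -, hP, hJ⟩ := hΦ x hx
  have h1 := hA x
  rw [hP] at h1
  obtain ⟨c, hc⟩ := h1
  refine ⟨c, ContinuousLinearMap.ext fun u => ?_⟩
  simp only [endCoord, ContinuousLinearMap.comp_apply, ← hc, hJ, Φ.coord_frame x hx]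

theorem frame_modelEnd_coord_mem (hΦ : Φ.IsAdapted P) (hx : x ∈ U) (c : Fin 3 → ℝ) :
    (Φ.frame x).comp ((modelEnd E c).comp (Φ.coord x)) ∈ P.fiber x := by
  obtain ⟨J₁, J₂, J₃, -, hP, hJ⟩ := hΦ x hx
  rw [hP]
  refine ⟨c, ?_⟩
  ext1 v
  rw [ContinuousLinearMap.comp_apply, ContinuousLinearMap.comp_apply, ← hJ, Φ.frame_coord x hx]

end Parallelization.IsAdapted

variable [FiniteDimensional ℝ E]

/-- Every bracket in the Nijenhuis tensor is expanded by the structure equation. The derivatives of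
the coordinates of `X` and `Y` cancel because the matrix of `I` squares to `ε`; what remains is the
torsion and the derivative of that matrix, which supplies `φ`. -/
theorem IsIntegrable.nijenhuisCondition [T2Space M] {I : EndField n M} {ε : ℝ}
    (hI : IsIntegrable ε I) (hIP : P.Compatible I) (hΦ : Φ.IsAdapted P) (hx : x ∈ U)
    {c : Fin 3 → ℝ} (hc : Φ.endCoord I x = modelEnd E c) (hcε : lorentz c c = ε) :
    NijenhuisCondition (Φ.torsion x) c := by
  obtain ⟨s, hs⟩ := (modelEnd E).exists_section_on_range
  -- The frame being adapted, the matrix of `I` stays in a fixed subspace, hence so does its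
  -- derivative.
  have hD : ∀ w, mvfderiv (𝓡 n) (Φ.endCoord I) x w ∈ LinearMap.range (modelEnd E) := fun w =>
    mvfderiv_mem _ ((Φ.contMDiffAt_endCoord hI.smooth hx).mdifferentiableAt (by simp))
      (by filter_upwards [Φ.mem_nhds hx] with y hy using hΦ.endCoord_mem hIP hy) w
  let D : E × E →ₗ[ℝ] (E × E →L[ℝ] E × E) :=
    ((mvfderiv (𝓡 n) (Φ.endCoord I) x).comp (Φ.frame x)).toLinearMap
  refine ⟨s.comp D, fun X₀ Y₀ => ?_⟩
  have hφ : ∀ u, modelEnd E (s.comp D u) =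
      mvfderiv (𝓡 n) (Φ.endCoord I) x (Φ.frame x u) := fun u => hs _ (hD _)
  rw [hφ, hφ, hφ, hφ]
  obtain ⟨X, hX, hX₀⟩ := exists_smoothVField (Φ.frame x X₀)
  obtain ⟨Y, hY, hY₀⟩ := exists_smoothVField (Φ.frame x Y₀)
  have dX : DiffFieldAt X x := hX.contMDiffAt.mdifferentiableAt (by simp)
  have dY : DiffFieldAt Y x := hY.contMDiffAt.mdifferentiableAt (by simp)
  have dIX : DiffFieldAt (fun y => I y (X y)) x :=
    (hI.smooth.smoothFieldAt_apply Filter.univ_mem hX.contMDiffAt).mdifferentiableAt (by simp)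
  have dIY : DiffFieldAt (fun y => I y (Y y)) x :=
    (hI.smooth.smoothFieldAt_apply Filter.univ_mem hY.contMDiffAt).mdifferentiableAt (by simp)
  have cX : Φ.coord x (X x) = X₀ := by rw [hX₀, Φ.coord_frame x hx]
  have cY : Φ.coord x (Y x) = Y₀ := by rw [hY₀, Φ.coord_frame x hx]
  have fX : Φ.frame x (modelEnd E c X₀) = I x (X x) := by
    rw [← cX, ← hc, ← Φ.coord_apply I hx, Φ.frame_coord x hx]
  have fY : Φ.frame x (modelEnd E c Y₀) = I x (Y x) := by
    rw [← cY, ← hc, ← Φ.coord_apply I hx, Φ.frame_coord x hx]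
  have hsq : ∀ u, modelEnd E c (modelEnd E c u) = ε • u := fun u => by
    rw [← hcε]
    exact DFunLike.congr_fun (modelEnd_mul_self c) u
  have h := congrArg (Φ.coord x) (hI.integrable X Y hX hY x)
  rw [nijenhuis, map_zero, map_sub, map_add, map_smul, Φ.coord_apply I hx, map_add,
    Φ.coord_mlieBracket hx dX dY, Φ.coord_mlieBracket hx dIX dIY, Φ.coord_mlieBracket hx dIX dY,
    Φ.coord_mlieBracket hx dX dIY, Φ.coord_apply I hx, Φ.coord_apply I hx,
    Φ.mvfderiv_coord_endField hI.smooth hx dX, Φ.mvfderiv_coord_endField hI.smooth hx dX,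
    Φ.mvfderiv_coord_endField hI.smooth hx dY, Φ.mvfderiv_coord_endField hI.smooth hx dY,
    hc, cX, cY] at h
  simp only [map_add, map_sub, hsq] at h
  rw [hcε, fX, fY, ← hX₀, ← hY₀]
  linear_combination (norm := module) -h

/-- The matrices, at a point, of the integrable structures which are compatible with `P`. -/
def Parallelization.integrableMatrices (Φ : Parallelization n (E × E) U)
    (P : AlmostParaQuaternionic n M) (x : M) : Set (Fin 3 → ℝ) :=
  {c | ∃ (ε : ℝ) (I : EndField n M), IsIntegrable ε I ∧ P.Compatible I ∧
    Φ.endCoord I x = modelEnd E c ∧ lorentz c c = ε}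

/-- A smooth torsion-free connection over `U` which preserves `P`. -/
structure IsLocalSolution (P : AlmostParaQuaternionic n M) (U : Set M)
    (nabla : VField n M → ∀ x : M, TangentSpace (𝓡 n) x →L[ℝ] TangentSpace (𝓡 n) x) : Prop where
  isCovariantDerivativeOn :
    IsCovariantDerivativeOn (I := 𝓡 n) (EuclideanSpace ℝ (Fin n)) nabla U
  contMDiff : ContMDiffCovariantDerivativeOn (I := 𝓡 n) (EuclideanSpace ℝ (Fin n)) ∞ nabla U
  torsion_free : ∀ x ∈ U, ∀ X Y : VField n M, DiffFieldAt X x → DiffFieldAt Y x →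
    nabla Y x (X x) - nabla X x (Y x) = VectorField.mlieBracket (𝓡 n) X Y x
  preserves : ∀ A : EndField n M, SmoothEndOn A Set.univ → P.Compatible A →
    ∀ x ∈ U, ∀ v : TangentSpace (𝓡 n) x, ∃ B ∈ P.fiber x, ∀ Y : VField n M, SmoothVField Y →
      B (Y x) = nabla (fun y => A y (Y y)) x v - A x (nabla Y x v)

theorem Parallelization.IsAdapted.exists_isLocalSolution [T2Space M] (hΦ : Φ.IsAdapted P)
    (h : ∀ x ∈ U, DeterminesCubics (Φ.integrableMatrices P x)) :
    ∃ nabla, IsLocalSolution P U nabla := by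
  obtain ⟨R, hR⟩ := exists_skewSymmetrization_rightInverse (normalizerForms E)
  have hR' : ∀ x ∈ U, R (Φ.torsion x) ∈ normalizerForms E ∧
      ∀ X Y, R (Φ.torsion x) X Y - R (Φ.torsion x) Y X = Φ.torsion x X Y := fun x hx => by
    refine hR _ (exists_normalizerForm (h x hx) ?_ (Φ.torsion_swap hx))
    rintro c ⟨ε, I, hI, hIP, hc, hcε⟩
    exact hI.nijenhuisCondition hIP hΦ hx hc hcε
  refine ⟨Φ.connection fun x => R (Φ.torsion x), Φ.isCovariantDerivativeOn_connection _,
    Φ.contMDiffCovariantDerivativeOn_connection fun x hx => ?_, fun x hx X Y hX hY =>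
    Φ.connection_sub_swap hx (hR' x hx).2 hX hY, fun A hA hAP x hx v => ?_⟩
  · exact Φ.contMDiffAt_linearMap_torsion hx R
  · obtain ⟨a, ha⟩ := hΦ.endCoord_mem hAP hx
    have h1 : mvfderiv (𝓡 n) (Φ.endCoord A) x v ∈ LinearMap.range (modelEnd E) :=
      mvfderiv_mem _ ((Φ.contMDiffAt_endCoord hA hx).mdifferentiableAt (by simp))
        (by filter_upwards [Φ.mem_nhds hx] with y hy using hΦ.endCoord_mem hAP hy) v
    have h2 : R (Φ.torsion x) (Φ.coord x v) * modelEnd E a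
        - modelEnd E a * R (Φ.torsion x) (Φ.coord x v) ∈ LinearMap.range (modelEnd E) :=
      (hR' x hx).1 (Φ.coord x v) a
    -- The matrix of `∇_v A` is `dA(v) - [Γ_v, A]`; the first term is in `sl(2)` as above, the
    -- second because `Γ_v` normalizes it.
    obtain ⟨b, hb⟩ := sub_mem h1 h2
    refine ⟨_, hΦ.frame_modelEnd_coord_mem hx b, fun Y hY => ?_⟩
    rw [Φ.connection_endField hA hx _ (hY.contMDiffAt.mdifferentiableAt (by simp)), ← ha, ← hb]
    rfl

end NijenhuisEquation

end ParaQuat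
end

noncomputable section

namespace ParaQuat

/-! ### Gluing the local connections. -/

section Gluing

variable {n : ℕ} {M : Type*} [TopologicalSpace M] [ChartedSpace (EuclideanSpace ℝ (Fin n)) M]
  [IsManifold (𝓡 n) ∞ M] [T2Space M] [SecondCountableTopology M]

/-- All the conditions on a connection are affine, so they survive convex combination with a
partition of unity. The Leibniz rule and the torsion equation use that the weights sum to `1`. -/
theorem AlmostParaQuaternionic.isParaQuaternionic_of_local (P : AlmostParaQuaternionic n M)
    (h : ∀ p : M, ∃ U : Set M, IsOpen U ∧ p ∈ U ∧ ∃ nabla, IsLocalSolution P U nabla) :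
    P.IsParaQuaternionic := by
  choose U hU hpU cov hcov using h
  have : SigmaCompactSpace M := by
    have : LocallyCompactSpace M := ChartedSpace.locallyCompactSpace (EuclideanSpace ℝ (Fin n)) M
    infer_instance
  obtain ⟨ρ, hρ⟩ := SmoothPartitionOfUnity.exists_isSubordinate (𝓡 n) isClosed_univ U hU
    fun x _ => Set.mem_iUnion.2 ⟨x, hpU x⟩
  have hmem : ∀ x, ∀ i ∈ ρ.finsupport x, x ∈ U i := fun x i hi =>
    hρ i (subset_closure ((ρ.mem_finsupport x).1 hi))
  have hsum : ∀ x, ∑ i ∈ ρ.finsupport x, ρ i x = 1 := fun x => ρ.sum_finsupport x (Set.mem_univ x)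
  let nabla : VField n M → ∀ x : M, TangentSpace (𝓡 n) x →L[ℝ] TangentSpace (𝓡 n) x :=
    fun X x => ∑ᶠ i, ρ i x • cov i X x
  have hnabla : ∀ X x, nabla X x = ∑ i ∈ ρ.finsupport x, ρ i x • cov i X x := fun X x => by
    refine finsum_eq_sum_of_support_subset _ fun i hi => ?_
    rw [Finset.mem_coe, ρ.mem_finsupport]
    exact left_ne_zero_of_smul hi
  have hcovd : IsCovariantDerivativeOn (I := 𝓡 n) (EuclideanSpace ℝ (Fin n)) nabla Set.univ :=
    { add := fun {X Y x} hX hY _ => by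
        rw [hnabla, hnabla, hnabla, ← Finset.sum_add_distrib]
        refine Finset.sum_congr rfl fun i hi => ?_
        rw [(hcov i).isCovariantDerivativeOn.add hX hY (hmem x i hi), smul_add]
      leibniz := fun {X f x} hX hf _ => by
        rw [hnabla, hnabla, Finset.smul_sum]
        conv_rhs => rw [← one_smul ℝ (ContinuousLinearMap.smulRight _ _), ← hsum x, Finset.sum_smul,
          ← Finset.sum_add_distrib]
        refine Finset.sum_congr rfl fun i hi => ?_
        rw [(hcov i).isCovariantDerivativeOn.leibniz hX hf (hmem x i hi), smul_add, smul_comm] }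
  refine ⟨⟨nabla, hcovd⟩, ⟨⟨fun {X} hX => ?_⟩⟩, ?_, ?_⟩
  · rw [contMDiffOn_univ]
    refine ContMDiff.finsum_section_of_locallyFinite ?_ fun i => ?_
    · refine ρ.locallyFinite.subset fun i x hx => ?_
      exact left_ne_zero_of_smul hx
    · exact ContMDiffOn.smul_section_of_tsupport (ρ i).contMDiff.contMDiffOn (hU i) (hρ i)
        ((hcov i).contMDiff.contMDiff (hX.mono (Set.subset_univ _)))
  · intro A hA hAP x v
    -- The value `0` where `x ∉ U i` makes the choice total in `i`; such indices do not enter the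
    -- sum.
    have hB : ∀ i, ∃ B ∈ P.fiber x, x ∈ U i → ∀ Y : VField n M, SmoothVField Y →
        B (Y x) = cov i (fun y => A y (Y y)) x v - A x (cov i Y x v) := fun i => by
      by_cases hx : x ∈ U i
      · obtain ⟨B, hB, hBY⟩ := (hcov i).preserves A hA hAP x hx v
        exact ⟨B, hB, fun _ => hBY⟩
      · exact ⟨0, zero_mem _, fun h => absurd h hx⟩
    choose B hB hBY using hB
    refine ⟨∑ i ∈ ρ.finsupport x, ρ i x • B i, Submodule.sum_mem _ fun i _ =>
      Submodule.smul_mem _ _ (hB i), fun Y hY => ?_⟩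
    change _ = nabla _ x v - A x (nabla Y x v)
    rw [hnabla, hnabla, sum_apply, sum_apply, sum_apply, map_sum, ← Finset.sum_sub_distrib]
    refine Finset.sum_congr rfl fun i hi => ?_
    simp only [FunLike.coe_smul, Pi.smul_apply, map_smul]
    rw [hBY i (hmem x i hi) Y hY, smul_sub]
  · rw [CovariantDerivative.torsion_eq_zero_iff]
    intro X Y x hX hY
    change nabla Y x (X x) - nabla X x (Y x) = _
    rw [hnabla, hnabla, sum_apply, sum_apply, ← Finset.sum_sub_distrib]
    simp only [FunLike.coe_smul, Pi.smul_apply]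
    conv_rhs => rw [← one_smul ℝ (VectorField.mlieBracket (𝓡 n) X Y x), ← hsum x, Finset.sum_smul]
    refine Finset.sum_congr rfl fun i hi => ?_
    rw [← smul_sub, (hcov i).torsion_free x (hmem x i hi) X Y hX hY]

end Gluing

/-! ### The hypotheses on the structures as conditions on coefficient triples. -/

section Cases

variable {n : ℕ} {M : Type*} [TopologicalSpace M] [ChartedSpace (EuclideanSpace ℝ (Fin n)) M]
  [IsManifold (𝓡 n) ∞ M] {E : Type*} [NormedAddCommGroup E] [NormedSpace ℝ E] {U : Set M}
  {Φ : Parallelization n (E × E) U} {P : AlmostParaQuaternionic n M} {x : M}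

/-- In an adapted frame the coefficients of an endomorphism with respect to the triple are also
those of its matrix. One triple serves all the structures, so independence and degeneracy at `x` can
be read on coefficients. -/
theorem Parallelization.IsAdapted.exists_coefficients (hΦ : Φ.IsAdapted P) (hn : n ≠ 0)
    (hx : x ∈ U) :
    ∃ J₁ J₂ J₃ : TangentSpace (𝓡 n) x →L[ℝ] TangentSpace (𝓡 n) x,
      IsAdmissibleTriple J₁ J₂ J₃ ∧ ∀ (ε : ℝ) (I : EndField n M), IsIntegrable ε I →
        P.Compatible I → ∃ c ∈ Φ.integrableMatrices P x,
          tripleMap J₁ J₂ J₃ c = I x ∧ lorentz c c = ε := by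
  obtain ⟨J₁, J₂, J₃, hJ, hP, hΦJ⟩ := hΦ x hx
  have hT : Module.finrank ℝ (TangentSpace (𝓡 n) x) ≠ 0 := by
    change Module.finrank ℝ (EuclideanSpace ℝ (Fin n)) ≠ 0
    rwa [finrank_euclideanSpace_fin]
  refine ⟨J₁, J₂, J₃, hJ, fun ε I hI hIP => ?_⟩
  have h1 := hIP x
  rw [hP] at h1
  obtain ⟨c, hc⟩ := h1
  have hcε : lorentz c c = ε := hJ.lorentz_of_sq hT (by rw [hc]; exact hI.sq x)
  refine ⟨c, ⟨ε, I, hI, hIP, ContinuousLinearMap.ext fun u => ?_, hcε⟩, hc, hcε⟩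
  simp only [Parallelization.endCoord, ContinuousLinearMap.comp_apply, ← hc, hΦJ,
    Φ.coord_frame x hx]

variable (hΦ : Φ.IsAdapted P) (hn : n ≠ 0) (hx : x ∈ U)
include hΦ hn hx

theorem determinesCubics_of_complex {ε : ℝ} (hε : ε = 1 ∨ ε = -1) {I₁ I₂ : EndField n M}
    (h₁ : IsIntegrable (-1) I₁) (h₂ : IsIntegrable ε I₂) (hP₁ : P.Compatible I₁)
    (hP₂ : P.Compatible I₂) (hind : LinearIndependent ℝ ![I₁ x, I₂ x]) :
    DeterminesCubics (Φ.integrableMatrices P x) := by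
  obtain ⟨J₁, J₂, J₃, hJ, hc⟩ := hΦ.exists_coefficients hn hx
  obtain ⟨c, hcS, hc₁, hcc⟩ := hc _ _ h₁ hP₁
  obtain ⟨d, hdS, hd₁, hdd⟩ := hc _ _ h₂ hP₂
  rw [← hc₁, ← hd₁] at hind
  refine determinesCubics_of_gram_ne_zero hcS hdS (by rw [hcc]; norm_num)
    (by rw [hdd]; rcases hε with rfl | rfl <;> norm_num)
    (gram_ne_zero_of_timelike hcc (by rwa [hdd]) (linearIndependent_pair_of_tripleMap hind))

theorem determinesCubics_of_isNondegenerateSpan {I₁ I₂ : EndField n M}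
    (h₁ : IsIntegrable 1 I₁) (h₂ : IsIntegrable 1 I₂) (hP₁ : P.Compatible I₁)
    (hP₂ : P.Compatible I₂) (hind : LinearIndependent ℝ ![I₁ x, I₂ x])
    (hdeg : IsNondegenerateSpan (I₁ x) (I₂ x)) :
    DeterminesCubics (Φ.integrableMatrices P x) := by
  obtain ⟨J₁, J₂, J₃, hJ, hc⟩ := hΦ.exists_coefficients hn hx
  have hT : Module.finrank ℝ (TangentSpace (𝓡 n) x) ≠ 0 := by
    change Module.finrank ℝ (EuclideanSpace ℝ (Fin n)) ≠ 0
    rwa [finrank_euclideanSpace_fin]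
  obtain ⟨c, hcS, hc₁, hcc⟩ := hc _ _ h₁ hP₁
  obtain ⟨d, hdS, hd₁, hdd⟩ := hc _ _ h₂ hP₂
  rw [← hc₁, ← hd₁] at hind hdeg
  have hg := gram_ne_zero_of_isNondegenerateSpan hind hdeg (by
    rw [hJ.stdMetric_tripleMap hT, hdd]; norm_num)
  simp only [hJ.stdMetric_tripleMap hT] at hg
  exact determinesCubics_of_gram_ne_zero hcS hdS (by rw [hcc]; norm_num) (by rw [hdd]; norm_num) hg

theorem determinesCubics_of_not_isNondegenerateSpan {I : Fin 3 → EndField n M}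
    (h : ∀ i, IsIntegrable 1 (I i)) (hP : ∀ i, P.Compatible (I i))
    (hind : ∀ i j, i ≠ j → LinearIndependent ℝ ![I i x, I j x])
    (hdep : ¬LinearIndependent ℝ fun i => I i x)
    (hdeg : ∀ i j, i ≠ j → ¬IsNondegenerateSpan (I i x) (I j x)) :
    DeterminesCubics (Φ.integrableMatrices P x) := by
  obtain ⟨J₁, J₂, J₃, hJ, hc⟩ := hΦ.exists_coefficients hn hx
  have hT : Module.finrank ℝ (TangentSpace (𝓡 n) x) ≠ 0 := by
    change Module.finrank ℝ (EuclideanSpace ℝ (Fin n)) ≠ 0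
    rwa [finrank_euclideanSpace_fin]
  choose c hcS hcI hcc using fun i => hc _ _ (h i) (hP i)
  simp only [← hcI] at hind hdep hdeg
  -- The Gram determinant of two spacelike unit vectors is `1 - ⟨cᵢ, cⱼ⟩²`.
  have hg : ∀ i j, i ≠ j → lorentz (c i) (c j) ^ 2 = 1 := fun i j hij => by
    have := gram_eq_zero_of_not_isNondegenerateSpan (hdeg i j hij)
    simp only [hJ.stdMetric_tripleMap hT, hcc] at this
    linarith
  refine determinesCubics_of_degenerate (hcS 0) (hcS 1) (hcS 2) (hcc 0) (hcc 1)
    (hg 0 1 (by decide)) (hg 0 2 (by decide)) (linearIndependent_pair_of_tripleMap (hind 0 1 (by decide)))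
    (linearIndependent_pair_of_tripleMap (hind 0 2 (by decide)))
    (linearIndependent_pair_of_tripleMap (hind 1 2 (by decide))) fun hli => hdep ?_
  have := hli.map' (tripleMap J₁ J₂ J₃) (LinearMap.ker_eq_bot.2 (hJ.tripleMap_injective hT))
  have hfun : tripleMap J₁ J₂ J₃ ∘ ![c 0, c 1, c 2] = fun i => tripleMap J₁ J₂ J₃ (c i) := by
    funext i
    fin_cases i <;> rfl
  rw [hfun] at this
  exact this

end Cases

end ParaQuat
end

theorem ParaQuat.AlmostParaQuaternionic.isParaQuaternionic_of_determinesCubics {n : ℕ} {M : Type*}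
    [TopologicalSpace M] [T2Space M] [SecondCountableTopology M]
    [ChartedSpace (EuclideanSpace ℝ (Fin n)) M] [IsManifold (𝓡 n) ∞ M]
    (P : ParaQuat.AlmostParaQuaternionic n M)
    (h : ∀ (k : ℕ) (U : Set M) (Φ : ParaQuat.Parallelization n ((Fin k → ℝ) × (Fin k → ℝ)) U),
      Φ.IsAdapted P → ∀ x ∈ U, ParaQuat.DeterminesCubics (Φ.integrableMatrices P x)) :
    P.IsParaQuaternionic := by
  refine P.isParaQuaternionic_of_local fun p => ?_
  obtain ⟨U, hp, k, Φ, hΦ⟩ := P.exists_adapted_parallelization p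
  exact ⟨U, Φ.isOpen, hp, hΦ.exists_isLocalSolution (h k U Φ hΦ)⟩

theorem theorem4p1 {m : ℕ} (hm : 2 ≤ m) {M : Type*} [TopologicalSpace M]
    [T2Space M] [SecondCountableTopology M]
    [ChartedSpace (EuclideanSpace ℝ (Fin (4 * m))) M] [IsManifold (𝓡 (4 * m)) ∞ M]
    (P : ParaQuat.AlmostParaQuaternionic (4 * m) M)
    (h :
      (∃ I₁ I₂ : ParaQuat.EndField (4 * m) M,
        (ParaQuat.IsComplexStructure I₁ ∨ ParaQuat.IsParaComplexStructure I₁) ∧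
        (ParaQuat.IsComplexStructure I₂ ∨ ParaQuat.IsParaComplexStructure I₂) ∧
        P.Compatible I₁ ∧ P.Compatible I₂ ∧
        (∀ p, LinearIndependent ℝ ![I₁ p, I₂ p]) ∧
        (ParaQuat.IsComplexStructure I₁ ∨ ParaQuat.IsComplexStructure I₂)) ∨
      (∃ I₁ I₂ : ParaQuat.EndField (4 * m) M,
        ParaQuat.IsParaComplexStructure I₁ ∧ ParaQuat.IsParaComplexStructure I₂ ∧
        P.Compatible I₁ ∧ P.Compatible I₂ ∧
        (∀ p, LinearIndependent ℝ ![I₁ p, I₂ p]) ∧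
        (∀ p, ParaQuat.IsNondegenerateSpan (I₁ p) (I₂ p))) ∨
      (∃ I : Fin 3 → ParaQuat.EndField (4 * m) M,
        (∀ i, ParaQuat.IsParaComplexStructure (I i)) ∧
        (∀ i, P.Compatible (I i)) ∧
        (∀ i j, i ≠ j → ∀ p, LinearIndependent ℝ ![I i p, I j p]) ∧
        (∀ p, ¬ LinearIndependent ℝ (fun i => I i p)) ∧
        (∀ i j, i ≠ j → ∀ p, ¬ ParaQuat.IsNondegenerateSpan (I i p) (I j p)))) :
    P.IsParaQuaternionic := by
  have hn : 4 * m ≠ 0 := by omega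
  refine P.isParaQuaternionic_of_determinesCubics fun k U Φ hΦ x hx => ?_
  rcases h with ⟨I₁, I₂, h₁, h₂, hP₁, hP₂, hind, hc | hc⟩ |
    ⟨I₁, I₂, h₁, h₂, hP₁, hP₂, hind, hdeg⟩ | ⟨I, hI, hP, hind, hdep, hdeg⟩
  · rcases h₂ with h₂ | h₂
    · exact ParaQuat.determinesCubics_of_complex hΦ hn hx (Or.inr rfl) hc.isIntegrable
        h₂.isIntegrable hP₁ hP₂ (hind x)
    · exact ParaQuat.determinesCubics_of_complex hΦ hn hx (Or.inl rfl) hc.isIntegrable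
        h₂.isIntegrable hP₁ hP₂ (hind x)
  · have hind' := LinearIndependent.pair_symm_iff.1 (hind x)
    rcases h₁ with h₁ | h₁
    · exact ParaQuat.determinesCubics_of_complex hΦ hn hx (Or.inr rfl) hc.isIntegrable
        h₁.isIntegrable hP₂ hP₁ hind'
    · exact ParaQuat.determinesCubics_of_complex hΦ hn hx (Or.inl rfl) hc.isIntegrable
        h₁.isIntegrable hP₂ hP₁ hind'
  · exact ParaQuat.determinesCubics_of_isNondegenerateSpan hΦ hn hx h₁.isIntegrable
      h₂.isIntegrable hP₁ hP₂ (hind x) (hdeg x)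
  · exact ParaQuat.determinesCubics_of_not_isNondegenerateSpan hΦ hn hx
      (fun i => (hI i).isIntegrable) hP (fun i j hij => hind i j hij x) (hdep x)
      fun i j hij => hdeg i j hij x
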